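/- Let $m\ge 1$ and let $P(\lambda)=\hat n(\lambda)/\hat d(\lambda)$ be a plant with a lag: $\hat n=\sum_{i=0}^m n_i\lambda^i$ and $\hat d=\sum_{i=0}^m d_i\lambda^i$ are coprime real polynomials with $n_0=0$, $d_0=1$, $d_m\neq 0$. Let $$\mathbf A=\begin{bmatrix}\mathbf 0&\mathbf I_{m-1}\\-d_m&\cdots\;-d_1\end{bmatrix},\quad \mathbf B=\begin{bmatrix}\mathbf 0\\1\end{bmatrix},\quad \mathbf C=[n_m,\dots,n_1],\quad \mathbf A^*=\begin{bmatrix}-d_{m-1}/d_m&\\ \vdots&\mathbf I_{m-1}\\-d_1/d_m&\\-1/d_m&\mathbf 0\end{bmatrix}.$$ For a set $S_k\subset\mathbb R^m$ of states and a measurement $z_k\in\mathbb R$ put $$S_{k+1}=\{\mathbf A\mathbf x+\mathbf Bu:\ \mathbf x\in S_k,\ |u|\le 1,\ |\mathbf C\mathbf x-z_k|\le 1\},\qquad \hat S_k=\{\mathbf x\in S_k:\ |\mathbf C\mathbf x-z_k|\le 1\},$$ so that $\hat S_k$ is the set of states in $S_k$ consistent with $z_k$ (and $\hat S_k=S_k$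 if all of them are). Assume that $\hat S_k$ is a polytope (the convex hull of a finite set) with non-empty interior. A face of a polytope is its intersection with a supporting hyperplane; facets, ridges and vertices are the faces of dimension $m-1$, $m-2$ and $0$; a direction of a facet is an outer normal vector $\mathbf f\ne\mathbf 0$ of it. Let $\mathbf v_1,\dots,\mathbf v_{n_v}$ be the vertices of $\hat S_k$, let $F_1,\dots,F_{n_f}$ be its facets with directions $\mathbf f_1,\dots,\mathbf f_{n_f}$, each vertex and each facet listed exactly once, and let $\mathcal I\in\{0,1\}^{n_f\times n_v}$ be the vertex-facet incidence matrix: $\mathcal I(i,j)=1$ if and only if $\mathbf v_j\in F_i$. Let $R_1,\dots,R_{n_R}$ be the ridges of $\hat S_k$, each listed once, that are the intersection of two facets with directions $\mathbf f,\mathbf f'$ such that $(\mathbf f)_1<0<(\mathbf f')_1$, and let $\mathbf f^R_l$ be the vector in the convex hull of two such directions for $R_l$ with $(\mathbf f^R_l)_1=0$. Define 0-1 matrices by * $\mathcal I^{\mathrm T}(i,j)=1$ iff $\mathcal I(i,j)=1$ and $d_m(\mathbf f_i)_1<0$; $\mathcal I^{\mathrm B}(i,j)=1$ iff $\mathcal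 I(i,j)=1$ and $d_m(\mathbf f_i)_1>0$; * $\mathcal IV^{\mathrm{PT}}(j)=1$ (respectively $\mathcal IV^{\mathrm{PB}}(j)=1$) iff the $j$-th column of $\mathcal I^{\mathrm T}$ (respectively $\mathcal I^{\mathrm B}$) is not zero; * $\mathcal IO^{\mathrm T}(i,j)=1$ (respectively $\mathcal IO^{\mathrm B}(i,j)=1$) iff $(\mathbf f_i)_1=0$, $\mathcal I(i,j)=1$ and $\mathcal IV^{\mathrm{PT}}(j)=1$ (respectively $\mathcal IV^{\mathrm{PB}}(j)=1$); * $\mathcal IR^{\mathrm T}(l,j)=1$ (respectively $\mathcal IR^{\mathrm B}(l,j)=1$) iff $\mathbf v_j\in R_l$ and $\mathcal IV^{\mathrm{PT}}(j)=1$ (respectively $\mathcal IV^{\mathrm{PB}}(j)=1$), and let $\mathcal I^+$ be the $(3n_f+n_R)\times 2n_v$ matrix $$\mathcal I^+=\begin{bmatrix}\mathcal I^{\mathrm T}&\mathbf 0\\ \mathbf 0&\mathcal I^{\mathrm B}\\ \mathcal IO^{\mathrm T}&\mathcal IO^{\mathrm B}\\ \mathcal IR^{\mathrm T}&\mathcal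 IR^{\mathrm B}\end{bmatrix},$$ whose columns are labelled by the points $\mathbf A\mathbf v_j+\mathbf B$ (first block) and $\mathbf A\mathbf v_j-\mathbf B$ (second block), and whose rows are labelled by the vectors $\mathbf A^*\mathbf f_i$ (first three blocks) and $\mathbf A^*\mathbf f^R_l$ (last block). Then $S_{k+1}$ is a polytope with non-empty interior, and $\mathcal I^+$ is, after removal of the rows and columns consisting entirely of zeros, its vertex-facet incidence matrix: the labels of the remaining columns are the vertices of $S_{k+1}$, each occurring exactly once; the labels of the remaining rows are directions of the facets of $S_{k+1}$, each facet occurring exactly once; and an entry is $1$ if the corresponding vertex lies on the corresponding facet, and $0$ otherwise. -/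

import Mathlib

open Matrix Polynomial

noncomputable section

/-! ### The plant and its state-space matrices -/

/-- A causal scalar plant `num / den` of order `m` with a lag: real coprime polynomials of degree at
most `m` in the unit delay, with `n_0 = 0`, `d_0 = 1` and `d_m ≠ 0`. -/
structure LagPlant (m : ℕ) where
  num : ℝ[X]
  den : ℝ[X]
  num_natDegree_le : num.natDegree ≤ m
  den_natDegree_le : den.natDegree ≤ m
  coprime : IsCoprime num den
  num_coeff_zero : num.coeff 0 = 0
  den_coeff_zero : den.coeff 0 = 1
  den_coeff_order_ne_zero : den.coeff m ≠ 0

namespace LagPlant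

variable {m : ℕ} (P : LagPlant m)

/-- The system matrix: ones on the superdiagonal, last row `(-d_m, …, -d_1)`. -/
def A : Matrix (Fin m) (Fin m) ℝ :=
  Matrix.of fun i j =>
    if (i : ℕ) + 1 = m then -P.den.coeff (m - j) else if (j : ℕ) = i + 1 then 1 else 0

/-- The input vector `(0, …, 0, 1)`; it depends on the order of the plant only. -/
def B (_P : LagPlant m) : Fin m → ℝ := fun i => if (i : ℕ) + 1 = m then 1 else 0

/-- The output vector `(n_m, …, n_1)`. -/
def C : Fin m → ℝ := fun j => P.num.coeff (m - j)

/-- The system matrix of the dual plant: first column `(-d_{m-1}/d_m, …, -d_1/d_m, -1/d_m)`, ones on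
the superdiagonal. -/
def Astar : Matrix (Fin m) (Fin m) ℝ :=
  Matrix.of fun i j =>
    if (j : ℕ) = 0 then -P.den.coeff (m - 1 - i) / P.den.coeff m
    else if (j : ℕ) = i + 1 then 1 else 0

/-- The states of `S` that are consistent with the measurement `z`. -/
def consistent (S : Set (Fin m → ℝ)) (z : ℝ) : Set (Fin m → ℝ) :=
  {x | x ∈ S ∧ |P.C ⬝ᵥ x - z| ≤ 1}

/-- One step of the recursion for uncertainty sets: the successors `A x + B u` of all states `x` of
`S`, with `|u| ≤ 1` and `|C x - z| ≤ 1`. -/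
def successors (S : Set (Fin m → ℝ)) (z : ℝ) : Set (Fin m → ℝ) :=
  {x' | ∃ x ∈ S, ∃ u y : ℝ, x' = P.A *ᵥ x + u • P.B ∧ y = P.C ⬝ᵥ x ∧ |u| ≤ 1 ∧ |y - z| ≤ 1}

/-- Propagation along the top side `u = 1`. -/
def gT (x : Fin m → ℝ) : Fin m → ℝ := P.A *ᵥ x + P.B

/-- Propagation along the bottom side `u = -1`. -/
def gB (x : Fin m → ℝ) : Fin m → ℝ := P.A *ᵥ x - P.B

end LagPlant

/-! ### Polytopes, faces, and the vertex-facet description -/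

section Polytopes

variable {m : ℕ}

/-- The convex hull of finitely many points. -/
def IsPolytope (S : Set (Fin m → ℝ)) : Prop :=
  ∃ t : Finset (Fin m → ℝ), S = convexHull ℝ (t : Set (Fin m → ℝ))

/-- A polytope with non-empty interior. -/
def IsFullDimPolytope (S : Set (Fin m → ℝ)) : Prop :=
  IsPolytope S ∧ (interior S).Nonempty

/-- The support function `h_S`. -/
def supportFn (S : Set (Fin m → ℝ)) (f : Fin m → ℝ) : ℝ :=
  sSup ((fun x => f ⬝ᵥ x) '' S)

/-- The supporting hyperplane `H_S(f)` (for `f ≠ 0`). -/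
def supportHyperplane (S : Set (Fin m → ℝ)) (f : Fin m → ℝ) : Set (Fin m → ℝ) :=
  {x | f ⬝ᵥ x = supportFn S f}

/-- The part of `S` on the supporting hyperplane with direction `f`. -/
def faceAt (S : Set (Fin m → ℝ)) (f : Fin m → ℝ) : Set (Fin m → ℝ) :=
  S ∩ supportHyperplane S f

/-- `G` is the intersection of `S` with a supporting hyperplane. -/
def IsFace (S G : Set (Fin m → ℝ)) : Prop :=
  ∃ f : Fin m → ℝ, f ≠ 0 ∧ G = faceAt S f

/-- The dimension of (the affine span of) a non-empty set. -/
def affDim (G : Set (Fin m → ℝ)) : ℕ :=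
  Module.finrank ℝ (vectorSpan ℝ G)

/-- A face of dimension `m - 1`. -/
def IsFacet (S G : Set (Fin m → ℝ)) : Prop :=
  IsFace S G ∧ affDim G + 1 = m

/-- A face of dimension `m - 2`. -/
def IsRidge (S G : Set (Fin m → ℝ)) : Prop :=
  IsFace S G ∧ affDim G + 2 = m

/-- The vertices: the points that form a face of dimension `0`. -/
def vertexSet (S : Set (Fin m → ℝ)) : Set (Fin m → ℝ) :=
  {v | IsFace S {v}}

/-- `f` is a direction (outer normal) of a facet of `S`. -/
def IsFacetDirection (S : Set (Fin m → ℝ)) (f : Fin m → ℝ) : Prop :=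
  f ≠ 0 ∧ IsFacet S (faceAt S f)

/-- The columns of `V` list the vertices of `S`, each once. -/
def IsVertexMatrix {ν : Type*} (S : Set (Fin m → ℝ)) (V : Matrix (Fin m) ν ℝ) : Prop :=
  Function.Injective V.col ∧ Set.range V.col = vertexSet S

/-- The columns of `F` list one direction for each facet of `S`, every facet being listed once. -/
def IsFacetMatrix {φ : Type*} (S : Set (Fin m → ℝ)) (F : Matrix (Fin m) φ ℝ) : Prop :=
  (∀ i, IsFacetDirection S (F.col i)) ∧
    Function.Injective (fun i => faceAt S (F.col i)) ∧
    Set.range (fun i => faceAt S (F.col i)) = {G | IsFacet S G}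

open Classical in
/-- The 0-1 matrix whose entry `(i, j)` tells whether the `j`-th column of `V` lies on the `i`-th
facet. -/
def incidenceMatrix {φ ν : Type*} (S : Set (Fin m → ℝ)) (V : Matrix (Fin m) ν ℝ)
    (F : Matrix (Fin m) φ ℝ) : Matrix φ ν ℕ :=
  Matrix.of fun i j => if V.col j ∈ faceAt S (F.col i) then 1 else 0

/-- `V`, `F`, `I` are a vertex matrix, a facet matrix and the corresponding vertex-facet incidence
matrix of `S`. -/
structure IsVertexFacetDescription {φ ν : Type*} (S : Set (Fin m → ℝ)) (V : Matrix (Fin m) ν ℝ)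
    (F : Matrix (Fin m) φ ℝ) (I : Matrix φ ν ℕ) : Prop where
  vertices : IsVertexMatrix S V
  facets : IsFacetMatrix S F
  incidence : I = incidenceMatrix S V F

/-- `G` is the intersection of two facets of `S` with directions `f₁`, `f₂` whose first components
are negative and positive, respectively. -/
def IsOppositeIntersection [NeZero m] (S G : Set (Fin m → ℝ)) (f₁ f₂ : Fin m → ℝ) : Prop :=
  IsFacetDirection S f₁ ∧ IsFacetDirection S f₂ ∧ f₁ 0 < 0 ∧ 0 < f₂ 0 ∧
    G = faceAt S f₁ ∩ faceAt S f₂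

/-- The set `R` of ridges in which two facets with directions of opposite first sign meet. -/
def oppositeRidges [NeZero m] (S : Set (Fin m → ℝ)) : Set (Set (Fin m → ℝ)) :=
  {G | IsRidge S G ∧ ∃ f₁ f₂, IsOppositeIntersection S G f₁ f₂}

/-- `g` is the direction in the convex hull of `f₁` and `f₂` with first component zero, where `f₁`
and `f₂` are directions of the two facets that meet in the ridge `G`. -/
def IsRidgeDirection [NeZero m] (S G : Set (Fin m → ℝ)) (g : Fin m → ℝ) : Prop :=
  ∃ f₁ f₂, IsOppositeIntersection S G f₁ f₂ ∧ g ∈ convexHull ℝ {f₁, f₂} ∧ g 0 = 0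

end Polytopes

/-! ### The table -/

section Table

variable {m nv nf nR : ℕ}

open Classical in
/-- The restriction of `I` to the rows picked by a logical vector: entry `1` where the row is picked and
`I` has entry `1`. -/
def selectRows (sel : Fin nf → ℕ) (I : Matrix (Fin nf) (Fin nv) ℕ) : Matrix (Fin nf) (Fin nv) ℕ :=
  Matrix.of fun i j => if I i j = 1 ∧ sel i = 1 then 1 else 0

open Classical in
/-- The logical vector of the columns of `J` that are not composed entirely of zeros. -/
def nonzeroCols (J : Matrix (Fin nf) (Fin nv) ℕ) : Fin nv → ℕ :=
  fun j => if J.col j ≠ 0 then 1 else 0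

namespace LagPlant

variable [NeZero m] (P : LagPlant m)

open Classical in
/-- `IF^T`: the facets with `d_m (f_i)_1 < 0`. -/
def IFT (F : Matrix (Fin m) (Fin nf) ℝ) : Fin nf → ℕ :=
  fun i => if P.den.coeff m * F 0 i < 0 then 1 else 0

open Classical in
/-- `IF^B`: the facets with `d_m (f_i)_1 > 0`. -/
def IFB (F : Matrix (Fin m) (Fin nf) ℝ) : Fin nf → ℕ :=
  fun i => if 0 < P.den.coeff m * F 0 i then 1 else 0

open Classical in
/-- `IF^O`: the facets with `(f_i)_1 = 0`. -/
def IFO (_P : LagPlant m) (F : Matrix (Fin m) (Fin nf) ℝ) : Fin nf → ℕ :=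
  fun i => if F 0 i = 0 then 1 else 0

def IT (F : Matrix (Fin m) (Fin nf) ℝ) (I : Matrix (Fin nf) (Fin nv) ℕ) :
    Matrix (Fin nf) (Fin nv) ℕ :=
  selectRows (P.IFT F) I

def IB (F : Matrix (Fin m) (Fin nf) ℝ) (I : Matrix (Fin nf) (Fin nv) ℕ) :
    Matrix (Fin nf) (Fin nv) ℕ :=
  selectRows (P.IFB F) I

/-- `IV^PT`: the non-zero columns of `I^T`. -/
def IVPT (F : Matrix (Fin m) (Fin nf) ℝ) (I : Matrix (Fin nf) (Fin nv) ℕ) : Fin nv → ℕ :=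
  nonzeroCols (P.IT F I)

/-- `IV^PB`: the non-zero columns of `I^B`. -/
def IVPB (F : Matrix (Fin m) (Fin nf) ℝ) (I : Matrix (Fin nf) (Fin nv) ℕ) : Fin nv → ℕ :=
  nonzeroCols (P.IB F I)

open Classical in
def IOT (F : Matrix (Fin m) (Fin nf) ℝ) (I : Matrix (Fin nf) (Fin nv) ℕ) :
    Matrix (Fin nf) (Fin nv) ℕ :=
  Matrix.of fun i j => if P.IFO F i = 1 ∧ P.IVPT F I j = 1 ∧ I i j = 1 then 1 else 0

open Classical in
def IOB (F : Matrix (Fin m) (Fin nf) ℝ) (I : Matrix (Fin nf) (Fin nv) ℕ) :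
    Matrix (Fin nf) (Fin nv) ℕ :=
  Matrix.of fun i j => if P.IFO F i = 1 ∧ P.IVPB F I j = 1 ∧ I i j = 1 then 1 else 0

open Classical in
/-- `IRV`: which vertices lie on which of the ridges `R l`. -/
def IRV (_P : LagPlant m) (V : Matrix (Fin m) (Fin nv) ℝ) (R : Fin nR → Set (Fin m → ℝ)) :
    Matrix (Fin nR) (Fin nv) ℕ :=
  Matrix.of fun l j => if V.col j ∈ R l then 1 else 0

open Classical in
def IRT (V : Matrix (Fin m) (Fin nv) ℝ) (F : Matrix (Fin m) (Fin nf) ℝ)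
    (I : Matrix (Fin nf) (Fin nv) ℕ) (R : Fin nR → Set (Fin m → ℝ)) :
    Matrix (Fin nR) (Fin nv) ℕ :=
  Matrix.of fun l j => if P.IVPT F I j = 1 ∧ P.IRV V R l j = 1 then 1 else 0

open Classical in
def IRB (V : Matrix (Fin m) (Fin nv) ℝ) (F : Matrix (Fin m) (Fin nf) ℝ)
    (I : Matrix (Fin nf) (Fin nv) ℕ) (R : Fin nR → Set (Fin m → ℝ)) :
    Matrix (Fin nR) (Fin nv) ℕ :=
  Matrix.of fun l j => if P.IVPB F I j = 1 ∧ P.IRV V R l j = 1 then 1 else 0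

/-- The body of the table, `(3 n_f + n_R) × 2 n_v`, before the removal of zero rows and columns. -/
def Iplus (V : Matrix (Fin m) (Fin nv) ℝ) (F : Matrix (Fin m) (Fin nf) ℝ)
    (I : Matrix (Fin nf) (Fin nv) ℕ) (R : Fin nR → Set (Fin m → ℝ)) :
    Matrix (Fin nf ⊕ (Fin nf ⊕ (Fin nf ⊕ Fin nR))) (Fin nv ⊕ Fin nv) ℕ :=
  fromRows (fromCols (P.IT F I) 0) <|
  fromRows (fromCols 0 (P.IB F I)) <|
  fromRows (fromCols (P.IOT F I) (P.IOB F I)) <|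
  fromCols (P.IRT V F I R) (P.IRB V F I R)

/-- The column headings of the table: `A v_j + B`, then `A v_j - B`. -/
def Vplus (V : Matrix (Fin m) (Fin nv) ℝ) : Matrix (Fin m) (Fin nv ⊕ Fin nv) ℝ :=
  fromCols (Matrix.of fun i j => P.gT (V.col j) i) (Matrix.of fun i j => P.gB (V.col j) i)

/-- The row headings of the table: `A* f_i` three times, then `A* f^R_l`. -/
def Fplus (F : Matrix (Fin m) (Fin nf) ℝ) (FR : Matrix (Fin m) (Fin nR) ℝ) :
    Matrix (Fin m) (Fin nf ⊕ (Fin nf ⊕ (Fin nf ⊕ Fin nR))) ℝ :=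
  fromCols (P.Astar * F) <| fromCols (P.Astar * F) <| fromCols (P.Astar * F) (P.Astar * FR)

end LagPlant

/-- The indices of the rows of `M` that are not composed entirely of zeros. -/
abbrev NonzeroRow {α β : Type*} (M : Matrix α β ℕ) : Type _ := {r : α // M.row r ≠ 0}

/-- The indices of the columns of `M` that are not composed entirely of zeros. -/
abbrev NonzeroCol {α β : Type*} (M : Matrix α β ℕ) : Type _ := {c : β // M.col c ≠ 0}

/-- `M` after the removal of the rows and columns that are composed entirely of zeros. -/
def removeZeros {α β : Type*} (M : Matrix α β ℕ) : Matrix (NonzeroRow M) (NonzeroCol M) ℕ :=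
  M.submatrix Subtype.val Subtype.val

end Table

end

/-!
Since `A e₀ = -d_m B`, the propagated set is the image under `A` of the polytope `K` of consistent
states swept along the segment from `e₀ / d_m` to `-e₀ / d_m`. The matrix `A*` is the inverse
transpose of `A`, so the face of the image at `A* f` consists of the `A x + u B` with `x` in the
face of `K` at `f` and `u` maximizing `u ⟨A* f, B⟩`, where `⟨A* f, B⟩ = -f₀ / d_m`
(`LagPlant.mem_faceAt_propagation_iff`). Everything is read off from this description.

* If `f₀ ≠ 0`, the face at `A* f` is a translated copy of the face at `f`: a facet exactly if the
  latter is one, a vertex exactly if the latter is one.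
* If `f₀ = 0`, it is the face at `f` swept along `B`, hence never a vertex. It is a facet either if
  the face at `f` is one or if that face is a ridge not parallel to `e₀`. In the second case the
  directions orthogonal to the ridge and to `e₀` form a line, so the ridge must be the intersection
  of two facets of opposite first sign (`exists_isOppositeIntersection`).
* `A v + B` is a vertex exactly if some `f` with `d_m f₀ < 0` singles out `v` in `K`, and this
  happens exactly if the vertex `v` lies on a facet with a direction of that sign
  (`exists_faceAt_eq_singleton_iff`).

Both existence statements rest on the fact that the normal cone along a face is generated by facet
directions. It is used in the form that a linear functional on a compact cross-section of the normal
cone attains its minimum at an extreme point (Krein–Milman), and that such an extreme point is the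
direction of a facet (`isFacetDirection_of_mem_extremePoints`). Conversely, a direction of a facet
through a vertex is perturbed to one that singles out the vertex without changing the sign of its
first component. A row of the table is non-zero as soon as its heading is the direction of a facet,
because every facet contains a vertex (`exists_mem_vertexSet_of_faceAt`).
-/

/-! ### Faces of compact sets -/

theorem IsPolytope.isCompact {m : ℕ} {S : Set (Fin m → ℝ)} (hS : IsPolytope S) : IsCompact S := by
  obtain ⟨t, rfl⟩ := hS
  exact t.finite_toSet.isCompact_convexHull ℝ

theorem continuous_dotProduct_const {m : ℕ} (f : Fin m → ℝ) :
    Continuous fun x : Fin m → ℝ => f ⬝ᵥ x := by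
  unfold dotProduct
  fun_prop

/-- On a compact set the supremum in `supportFn` is attained, so that a face consists of the
maximizers of its direction. -/
theorem mem_faceAt {m : ℕ} {S : Set (Fin m → ℝ)} (hS : IsCompact S) {f x : Fin m → ℝ} :
    x ∈ faceAt S f ↔ x ∈ S ∧ ∀ y ∈ S, f ⬝ᵥ y ≤ f ⬝ᵥ x := by
  have hbdd : BddAbove ((fun x => f ⬝ᵥ x) '' S) :=
    (hS.image (continuous_dotProduct_const f)).bddAbove
  constructor
  · rintro ⟨hx, hfx⟩
    refine ⟨hx, fun y hy => ?_⟩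
    change f ⬝ᵥ x = supportFn S f at hfx
    rw [hfx]
    exact le_csSup hbdd ⟨y, hy, rfl⟩
  · rintro ⟨hx, h⟩
    refine ⟨hx, le_antisymm (le_csSup hbdd ⟨x, hx, rfl⟩) (csSup_le ⟨_, x, hx, rfl⟩ ?_)⟩
    rintro _ ⟨y, hy, rfl⟩
    exact h y hy

theorem faceAt_nonempty {m : ℕ} {S : Set (Fin m → ℝ)} (hS : IsCompact S) (hne : S.Nonempty)
    (f : Fin m → ℝ) : (faceAt S f).Nonempty := by
  obtain ⟨x, hx, hmax⟩ := hS.exists_isMaxOn hne (continuous_dotProduct_const f).continuousOn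
  exact ⟨x, (mem_faceAt hS).2 ⟨hx, fun y hy => hmax hy⟩⟩

theorem dotProduct_eq_of_mem_faceAt {m : ℕ} {S : Set (Fin m → ℝ)} {f x y : Fin m → ℝ}
    (hx : x ∈ faceAt S f) (hy : y ∈ faceAt S f) : f ⬝ᵥ x = f ⬝ᵥ y :=
  hx.2.trans hy.2.symm

theorem dotProduct_self_pos {m : ℕ} {f : Fin m → ℝ} (hf : f ≠ 0) : 0 < f ⬝ᵥ f :=
  lt_of_le_of_ne (Finset.sum_nonneg fun i _ => mul_self_nonneg (f i))
    fun h => hf (dotProduct_self_eq_zero.1 h.symm)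

theorem dotProduct_lt_of_mem_interior {m : ℕ} {S : Set (Fin m → ℝ)} (hS : IsCompact S)
    {f p x : Fin m → ℝ} (hf : f ≠ 0) (hp : p ∈ interior S) (hx : x ∈ faceAt S f) :
    f ⬝ᵥ p < f ⬝ᵥ x := by
  have hcont : Filter.Tendsto (fun s : ℝ => p + s • f) (nhds 0) (nhds p) := by
    have : Continuous fun s : ℝ => p + s • f := by fun_prop
    simpa using this.tendsto 0
  have hev : ∀ᶠ s : ℝ in nhds 0, p + s • f ∈ S := hcont (mem_interior_iff_mem_nhds.1 hp)
  obtain ⟨s, hs, hs0⟩ := ((hev.filter_mono nhdsWithin_le_nhds).and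
    (self_mem_nhdsWithin : Set.Ioi (0 : ℝ) ∈ nhdsWithin 0 (Set.Ioi 0))).exists
  have h := ((mem_faceAt hS).1 hx).2 _ hs
  rw [dotProduct_add, dotProduct_smul, smul_eq_mul] at h
  have := mul_pos (Set.mem_Ioi.1 hs0) (dotProduct_self_pos hf)
  linarith

theorem eq_zero_of_dotProduct_const {m : ℕ} {S : Set (Fin m → ℝ)} (hS : IsCompact S)
    (hint : (interior S).Nonempty) {f x : Fin m → ℝ} (hx : x ∈ S)
    (h : ∀ y ∈ S, f ⬝ᵥ y = f ⬝ᵥ x) : f = 0 := by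
  by_contra hf
  obtain ⟨p, hp⟩ := hint
  have := dotProduct_lt_of_mem_interior hS hf hp
    ((mem_faceAt hS).2 ⟨hx, fun y hy => (h y hy).le⟩)
  exact this.ne (h p (interior_subset hp))

theorem faceAt_smul {m : ℕ} {S : Set (Fin m → ℝ)} (hS : IsCompact S) {c : ℝ} (hc : 0 < c)
    (f : Fin m → ℝ) : faceAt S (c • f) = faceAt S f := by
  ext x
  simp only [mem_faceAt hS, smul_dotProduct, smul_eq_mul, mul_le_mul_iff_right₀ hc]

/-- A positive combination of two directions whose faces meet has the intersection as its face. -/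
theorem faceAt_add_smul {m : ℕ} {S : Set (Fin m → ℝ)} (hS : IsCompact S) {a b : ℝ} (ha : 0 < a)
    (hb : 0 < b) {f g : Fin m → ℝ} (hne : (faceAt S f ∩ faceAt S g).Nonempty) :
    faceAt S (a • f + b • g) = faceAt S f ∩ faceAt S g := by
  obtain ⟨x, hxf, hxg⟩ := hne
  have hxf' := (mem_faceAt hS).1 hxf
  have hxg' := (mem_faceAt hS).1 hxg
  ext y
  simp only [Set.mem_inter_iff, mem_faceAt hS, add_dotProduct, smul_dotProduct, smul_eq_mul]
  constructor
  · rintro ⟨hy, h⟩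
    have h1 := mul_le_mul_of_nonneg_left (hxf'.2 y hy) ha.le
    have h2 := mul_le_mul_of_nonneg_left (hxg'.2 y hy) hb.le
    have h3 := h x hxf'.1
    have h4 : f ⬝ᵥ y = f ⬝ᵥ x := mul_left_cancel₀ ha.ne' (by linarith)
    have h5 : g ⬝ᵥ y = g ⬝ᵥ x := mul_left_cancel₀ hb.ne' (by linarith)
    exact ⟨⟨hy, fun z hz => h4 ▸ hxf'.2 z hz⟩, hy, fun z hz => h5 ▸ hxg'.2 z hz⟩
  · rintro ⟨⟨hy, h1⟩, -, h2⟩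
    exact ⟨hy, fun z hz => add_le_add (mul_le_mul_of_nonneg_left (h1 z hz) ha.le)
      (mul_le_mul_of_nonneg_left (h2 z hz) hb.le)⟩

/-! ### Orthogonal complements for the dot product -/

/-- The vectors whose dot product with every element of `W` vanishes. -/
def perp {m : ℕ} (W : Submodule ℝ (Fin m → ℝ)) : Submodule ℝ (Fin m → ℝ) :=
  W.dualAnnihilator.comap (dotProductEquiv ℝ (Fin m)).toLinearMap

theorem mem_perp {m : ℕ} {W : Submodule ℝ (Fin m → ℝ)} {f : Fin m → ℝ} :
    f ∈ perp W ↔ ∀ w ∈ W, f ⬝ᵥ w = 0 := by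
  simp [perp, Submodule.mem_dualAnnihilator]

theorem finrank_add_finrank_perp {m : ℕ} (W : Submodule ℝ (Fin m → ℝ)) :
    Module.finrank ℝ W + Module.finrank ℝ (perp W) = m := by
  have h := Subspace.finrank_add_finrank_dualAnnihilator_eq W
  rw [Module.finrank_fin_fun] at h
  rw [perp, Submodule.comap_equiv_eq_map_symm, LinearEquiv.finrank_map_eq]
  exact h

theorem finrank_lt_of_mem_perp {m : ℕ} {W : Submodule ℝ (Fin m → ℝ)} {f : Fin m → ℝ}
    (hf : f ≠ 0) (h : f ∈ perp W) : Module.finrank ℝ W < m := by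
  have h1 := finrank_add_finrank_perp W
  have h2 : Module.finrank ℝ (perp W) ≠ 0 := fun h0 => by
    rw [Submodule.finrank_eq_zero] at h0
    rw [h0] at h
    exact hf h
  omega

theorem exists_mem_perp_ne_zero {m : ℕ} {W : Submodule ℝ (Fin m → ℝ)}
    (h : Module.finrank ℝ W < m) : ∃ f ∈ perp W, f ≠ 0 := by
  have h1 := finrank_add_finrank_perp W
  refine Submodule.exists_mem_ne_zero_of_ne_bot fun h0 => ?_
  rw [h0, finrank_bot] at h1
  omega

theorem exists_smul_eq_of_mem_perp {m : ℕ} {W : Submodule ℝ (Fin m → ℝ)}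
    (hW : Module.finrank ℝ W + 1 = m) {f g : Fin m → ℝ} (hf0 : f ≠ 0) (hf : f ∈ perp W)
    (hg : g ∈ perp W) : ∃ c : ℝ, g = c • f := by
  have h1 := finrank_add_finrank_perp W
  have h2 : Module.finrank ℝ (perp W) = 1 := by omega
  have h3 : (⟨f, hf⟩ : perp W) ≠ 0 := fun h => hf0 (congrArg Subtype.val h)
  obtain ⟨c, hc⟩ := (finrank_eq_one_iff_of_nonzero' _ h3).1 h2 ⟨g, hg⟩
  exact ⟨c, (congrArg Subtype.val hc).symm⟩

theorem mem_perp_vectorSpan {m : ℕ} {G : Set (Fin m → ℝ)} {f : Fin m → ℝ} :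
    f ∈ perp (vectorSpan ℝ G) ↔ ∀ x ∈ G, ∀ y ∈ G, f ⬝ᵥ x = f ⬝ᵥ y := by
  constructor
  · intro h x hx y hy
    have := mem_perp.1 h _ (vsub_mem_vectorSpan ℝ hx hy)
    rw [vsub_eq_sub, dotProduct_sub] at this
    linarith
  · intro h
    refine mem_perp.2 fun w hw => ?_
    rw [vectorSpan_def] at hw
    induction hw using Submodule.span_induction with
    | mem w hw =>
      obtain ⟨x, hx, y, hy, rfl⟩ := hw
      simp only [vsub_eq_sub]
      rw [dotProduct_sub, h x hx y hy, sub_self]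
    | zero => simp
    | add u v _ _ hu hv => rw [dotProduct_add, hu, hv, add_zero]
    | smul c u _ hu => rw [dotProduct_smul, hu, smul_zero]

theorem mem_perp_vectorSpan_faceAt {m : ℕ} {S G : Set (Fin m → ℝ)} {f : Fin m → ℝ}
    (h : G ⊆ faceAt S f) : f ∈ perp (vectorSpan ℝ G) :=
  mem_perp_vectorSpan.2 fun _ hx _ hy => dotProduct_eq_of_mem_faceAt (h hx) (h hy)

theorem mem_perp_sup_span {m : ℕ} {W : Submodule ℝ (Fin m → ℝ)} {e f : Fin m → ℝ} :
    f ∈ perp (W ⊔ Submodule.span ℝ {e}) ↔ f ∈ perp W ∧ f ⬝ᵥ e = 0 := by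
  simp only [mem_perp]
  constructor
  · intro h
    exact ⟨fun w hw => h w (Submodule.mem_sup_left hw),
      h e (Submodule.mem_sup_right (Submodule.mem_span_singleton_self e))⟩
  · rintro ⟨h1, h2⟩ w hw
    obtain ⟨u, hu, v, hv, rfl⟩ := Submodule.mem_sup.1 hw
    obtain ⟨c, rfl⟩ := Submodule.mem_span_singleton.1 hv
    rw [dotProduct_add, h1 u hu, dotProduct_smul, h2, smul_zero, add_zero]

theorem mem_of_forall_perp {m : ℕ} {W : Submodule ℝ (Fin m → ℝ)} {e : Fin m → ℝ}
    (h : ∀ f ∈ perp W, f ⬝ᵥ e = 0) : e ∈ W := by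
  have h1 : perp (W ⊔ Submodule.span ℝ {e}) = perp W := by
    ext f
    exact ⟨fun hf => (mem_perp_sup_span.1 hf).1, fun hf => mem_perp_sup_span.2 ⟨hf, h f hf⟩⟩
  have h2 := finrank_add_finrank_perp W
  have h3 := finrank_add_finrank_perp (W ⊔ Submodule.span ℝ {e})
  rw [h1] at h3
  have h4 : W = W ⊔ Submodule.span ℝ {e} :=
    Submodule.eq_of_le_of_finrank_eq le_sup_left (by omega)
  rw [h4]
  exact Submodule.mem_sup_right (Submodule.mem_span_singleton_self e)

theorem finrank_sup_span_of_notMem {m : ℕ} {W : Submodule ℝ (Fin m → ℝ)} {e : Fin m → ℝ}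
    (h : e ∉ W) :
    Module.finrank ℝ (W ⊔ Submodule.span ℝ {e} : Submodule ℝ (Fin m → ℝ)) =
      Module.finrank ℝ W + 1 := by
  have h1 : Module.finrank ℝ (Submodule.span ℝ {e}) ≤ 1 := by
    simpa using finrank_span_le_card (R := ℝ) ({e} : Set (Fin m → ℝ))
  have h2 := Submodule.finrank_add_le_finrank_add_finrank W (Submodule.span ℝ {e})
  have h3 : W < W ⊔ Submodule.span ℝ {e} :=
    lt_of_le_of_ne le_sup_left fun h4 => h <| by
      rw [h4]
      exact Submodule.mem_sup_right (Submodule.mem_span_singleton_self e)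
  have h4 := Submodule.finrank_lt_finrank_of_lt h3
  omega

/-! ### Facet directions -/

theorem affDim_faceAt_lt {m : ℕ} {S : Set (Fin m → ℝ)} {f : Fin m → ℝ} (hf : f ≠ 0) :
    affDim (faceAt S f) < m :=
  finrank_lt_of_mem_perp hf (mem_perp_vectorSpan_faceAt subset_rfl)

/-- Two directions of one facet are positive multiples of each other. -/
theorem exists_pos_smul_eq_of_faceAt_eq {m : ℕ} {S : Set (Fin m → ℝ)} (hS : IsCompact S)
    (hint : (interior S).Nonempty) {f g : Fin m → ℝ} (hf : IsFacetDirection S f) (hg : g ≠ 0)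
    (h : faceAt S f = faceAt S g) : ∃ c : ℝ, 0 < c ∧ g = c • f := by
  obtain ⟨c, rfl⟩ := exists_smul_eq_of_mem_perp hf.2.2 hf.1
    (mem_perp_vectorSpan_faceAt subset_rfl) (mem_perp_vectorSpan_faceAt h.subset)
  refine ⟨c, lt_of_not_ge fun hc => hf.1 ?_, rfl⟩
  obtain ⟨x, hx⟩ := faceAt_nonempty hS (hint.mono interior_subset) f
  refine eq_zero_of_dotProduct_const hS hint hx.1 fun y hy =>
    le_antisymm (((mem_faceAt hS).1 hx).2 y hy) ?_
  have hc0 : c ≠ 0 := by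
    rintro rfl
    simp at hg
  rw [h] at hx
  have h1 := ((mem_faceAt hS).1 hx).2 y hy
  rw [smul_dotProduct, smul_dotProduct, smul_eq_mul, smul_eq_mul] at h1
  exact (mul_le_mul_left_of_neg (lt_of_le_of_ne hc hc0)).1 h1

/-! ### Perturbation of directions of a polytope -/

/-- The points of a finite set that lie strictly below `x` in direction `f` stay there after a small
perturbation of `f`. -/
theorem eventually_dotProduct_lt {m : ℕ} (t : Finset (Fin m → ℝ)) (f g x : Fin m → ℝ) :
    ∀ᶠ s : ℝ in nhds 0, ∀ u ∈ t, f ⬝ᵥ u < f ⬝ᵥ x → (f + s • g) ⬝ᵥ u < (f + s • g) ⬝ᵥ x := by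
  rw [Filter.eventually_all_finset]
  intro u _
  by_cases h : f ⬝ᵥ u < f ⬝ᵥ x
  · have hc : Continuous fun s : ℝ => (f + s • g) ⬝ᵥ x - (f + s • g) ⬝ᵥ u := by
      simp only [add_dotProduct, smul_dotProduct]
      fun_prop
    have h0 := hc.tendsto 0
    simp only [zero_smul, add_zero] at h0
    filter_upwards [h0.eventually (lt_mem_nhds (sub_pos.2 h))] with s hs _
    exact sub_pos.1 hs
  · exact Filter.Eventually.of_forall fun _ h' => absurd h' h

theorem dotProduct_le_of_mem_convexHull {m : ℕ} {t : Set (Fin m → ℝ)} {f x y : Fin m → ℝ}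
    (h : ∀ u ∈ t, f ⬝ᵥ u ≤ f ⬝ᵥ x) (hy : y ∈ convexHull ℝ t) : f ⬝ᵥ y ≤ f ⬝ᵥ x := by
  have hc : Convex ℝ {y : Fin m → ℝ | f ⬝ᵥ y ≤ f ⬝ᵥ x} :=
    convex_halfSpace_le (IsLinearMap.mk (dotProduct_add f) fun c y => dotProduct_smul c f y) _
  exact convexHull_min h hc hy

theorem faceAt_convexHull_eq_singleton {m : ℕ} {t : Finset (Fin m → ℝ)} {f x : Fin m → ℝ}
    (hx : x ∈ convexHull ℝ (t : Set (Fin m → ℝ))) (h : ∀ u ∈ t, u ≠ x → f ⬝ᵥ u < f ⬝ᵥ x) :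
    faceAt (convexHull ℝ (t : Set (Fin m → ℝ))) f = {x} := by
  have hK : IsCompact (convexHull ℝ (t : Set (Fin m → ℝ))) := t.finite_toSet.isCompact_convexHull ℝ
  have hc : Convex ℝ {y : Fin m → ℝ | y = x ∨ f ⬝ᵥ y < f ⬝ᵥ x} := by
    rintro y hy z hz a b ha hb hab
    rcases ha.eq_or_lt with rfl | ha
    · obtain rfl : b = 1 := by linarith
      simpa using hz
    rcases hb.eq_or_lt with rfl | hb
    · obtain rfl : a = 1 := by linarith
      simpa using hy
    simp only [Set.mem_ofPred_eq, dotProduct_add, dotProduct_smul, smul_eq_mul] at hy hz ⊢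
    obtain rfl : b = 1 - a := by linarith
    rcases hy with rfl | hy
    · rcases hz with rfl | hz
      · left
        rw [← add_smul, hab, one_smul]
      · right
        nlinarith [mul_lt_mul_of_pos_left hz hb]
    · right
      have h1 := mul_lt_mul_of_pos_left hy ha
      rcases hz with rfl | hz
      · linarith
      · have h2 := mul_lt_mul_of_pos_left hz hb
        linarith
  have hlt : ∀ y ∈ convexHull ℝ (t : Set (Fin m → ℝ)), y = x ∨ f ⬝ᵥ y < f ⬝ᵥ x := fun y hy =>
    convexHull_min (fun u hu => or_iff_not_imp_left.2 (h u hu)) hc hy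
  ext y
  rw [mem_faceAt hK, Set.mem_singleton_iff]
  constructor
  · rintro ⟨hy, hmax⟩
    exact (hlt y hy).resolve_right (hmax x hx).not_gt
  · rintro rfl
    exact ⟨hx, fun z hz => (hlt z hz).elim (fun h => h ▸ le_rfl) le_of_lt⟩

/-- If `g` singles out `x` within the face at `f`, then `f + s g` singles out `x` within the whole
polytope for all small positive `s`. -/
theorem eventually_faceAt_eq_singleton {m : ℕ} {S : Set (Fin m → ℝ)} (hS : IsPolytope S)
    {f g x : Fin m → ℝ} (hx : x ∈ faceAt S f)
    (h : ∀ u ∈ faceAt S f, u ≠ x → g ⬝ᵥ u < g ⬝ᵥ x) :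
    ∀ᶠ s : ℝ in nhdsWithin 0 (Set.Ioi 0), faceAt S (f + s • g) = {x} := by
  have hK := hS.isCompact
  obtain ⟨t, rfl⟩ := hS
  filter_upwards [(eventually_dotProduct_lt t f g x).filter_mono nhdsWithin_le_nhds,
    self_mem_nhdsWithin] with s hs hs0
  refine faceAt_convexHull_eq_singleton hx.1 fun u hu hux => ?_
  have huK := subset_convexHull ℝ (t : Set (Fin m → ℝ)) hu
  have hle := ((mem_faceAt hK).1 hx).2 u huK
  rcases hle.lt_or_eq with hlt | heq
  · exact hs u hu hlt
  · have h1 := h u ((mem_faceAt hK).2 ⟨huK, fun y hy => heq ▸ ((mem_faceAt hK).1 hx).2 y hy⟩) hux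
    have h2 := mul_lt_mul_of_pos_left h1 (Set.mem_Ioi.1 hs0)
    simp only [add_dotProduct, smul_dotProduct, smul_eq_mul]
    linarith

theorem ne_zero_of_faceAt_eq_singleton {m : ℕ} [NeZero m] {S : Set (Fin m → ℝ)}
    (hS : IsCompact S) (hint : (interior S).Nonempty) {f x : Fin m → ℝ}
    (h : faceAt S f = {x}) : f ≠ 0 := by
  rintro rfl
  have hx : x ∈ S := (h ▸ Set.mem_singleton x : x ∈ faceAt S 0).1
  have h1 : S ⊆ {x} := fun y hy => h ▸ (mem_faceAt hS).2 ⟨hy, fun z _ => by simp⟩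
  have h2 : (fun _ => 1 : Fin m → ℝ) = 0 :=
    eq_zero_of_dotProduct_const hS hint hx fun y hy => by rw [h1 hy]
  exact one_ne_zero (congrFun h2 0)

/-- Every face of a polytope contains a vertex: a point of the face at maximal Euclidean
distance from the origin is singled out within the face by its own position vector. -/
theorem exists_mem_vertexSet_of_faceAt {m : ℕ} [NeZero m] {S : Set (Fin m → ℝ)}
    (hS : IsFullDimPolytope S) (f : Fin m → ℝ) : ∃ v ∈ vertexSet S, v ∈ faceAt S f := by
  have hK := hS.1.isCompact
  obtain ⟨x, hx⟩ := faceAt_nonempty hK (hS.2.mono interior_subset) f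
  have hcF : IsCompact (faceAt S f) :=
    hK.inter_right (isClosed_eq (continuous_dotProduct_const f) continuous_const)
  have hc2 : Continuous fun x : Fin m → ℝ => x ⬝ᵥ x := by
    unfold dotProduct
    fun_prop
  obtain ⟨v, hv, hmax⟩ := hcF.exists_isMaxOn ⟨x, hx⟩ hc2.continuousOn
  have h1 : ∀ u ∈ faceAt S f, u ≠ v → v ⬝ᵥ u < v ⬝ᵥ v := by
    intro u hu huv
    have h2 : u ⬝ᵥ u ≤ v ⬝ᵥ v := hmax hu
    have h3 := dotProduct_self_pos (sub_ne_zero.2 huv)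
    simp only [dotProduct_sub, sub_dotProduct, dotProduct_comm u v] at h3
    linarith
  obtain ⟨s, hs⟩ := (eventually_faceAt_eq_singleton hS.1 hv h1).exists
  exact ⟨v, ⟨_, ne_zero_of_faceAt_eq_singleton hK hS.2 hs, hs.symm⟩, hv⟩

/-! ### Normal cones are generated by facet directions -/

/-- A bounded cross-section of the normal cone of `S` along `G`: the directions whose face contains
`G`, normalized by their value on a fixed vector `q` (pointing from `G` to an interior point). -/
def normalSection {m : ℕ} (S G : Set (Fin m → ℝ)) (q : Fin m → ℝ) : Set (Fin m → ℝ) :=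
  {g | (∀ x ∈ G, ∀ y ∈ S, g ⬝ᵥ y ≤ g ⬝ᵥ x) ∧ g ⬝ᵥ q = -1}

theorem subset_faceAt_iff {m : ℕ} {S G : Set (Fin m → ℝ)} (hS : IsCompact S) (hGS : G ⊆ S)
    {g : Fin m → ℝ} : G ⊆ faceAt S g ↔ ∀ x ∈ G, ∀ y ∈ S, g ⬝ᵥ y ≤ g ⬝ᵥ x :=
  ⟨fun h _ hx => ((mem_faceAt hS).1 (h hx)).2, fun h x hx => (mem_faceAt hS).2 ⟨hGS hx, h x hx⟩⟩

theorem isCompact_normalSection {m : ℕ} {S G : Set (Fin m → ℝ)} {p x : Fin m → ℝ}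
    (hp : p ∈ interior S) (hx : x ∈ G) : IsCompact (normalSection S G (p - x)) := by
  have hc : ∀ y : Fin m → ℝ, Continuous fun g : Fin m → ℝ => g ⬝ᵥ y := fun y => by
    unfold dotProduct
    fun_prop
  have hclosed : IsClosed (normalSection S G (p - x)) := by
    have : normalSection S G (p - x) =
        (⋂ x ∈ G, ⋂ y ∈ S, {g | g ⬝ᵥ y ≤ g ⬝ᵥ x}) ∩ {g | g ⬝ᵥ (p - x) = -1} := by
      ext g
      simp [normalSection]
    rw [this]
    refine IsClosed.inter ?_ (isClosed_eq (hc _) continuous_const)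
    exact isClosed_biInter fun x _ => isClosed_biInter fun y _ => isClosed_le (hc y) (hc x)
  obtain ⟨r, hr, hball⟩ := Metric.nhds_basis_closedBall.mem_iff.1 (mem_interior_iff_mem_nhds.1 hp)
  -- Testing with `p ± r eᵢ ∈ S` bounds every coordinate by `1 / r`.
  have key : ∀ g ∈ normalSection S G (p - x), ∀ i, ∀ σ : ℝ, |σ| = r → σ * g i ≤ 1 := by
    rintro g ⟨hg, hq⟩ i σ hσ
    have hmem : p + Pi.single i σ ∈ S := by
      refine hball ?_
      rw [mem_closedBall_iff_norm, add_sub_cancel_left, Pi.norm_single, Real.norm_eq_abs, hσ]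
    have h := hg x hx _ hmem
    rw [dotProduct_add, dotProduct_single] at h
    rw [dotProduct_sub] at hq
    linarith
  refine (isCompact_Icc (a := fun _ : Fin m => -(1 / r)) (b := fun _ => 1 / r)).of_isClosed_subset
    hclosed fun g hg => ⟨fun i => ?_, fun i => ?_⟩
  · have h := key g hg i (-r) (by rw [abs_neg, abs_of_pos hr])
    rw [neg_le, le_div_iff₀ hr]
    linarith
  · have h := key g hg i r (abs_of_pos hr)
    rw [le_div_iff₀ hr]
    linarith

/-- An extreme point of the normalized normal cone is a facet direction: otherwise it could be moved
in both directions along a vector orthogonal to its face and to the normalizing vector. -/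
theorem isFacetDirection_of_mem_extremePoints {m : ℕ} {S G : Set (Fin m → ℝ)}
    (hS : IsPolytope S) (hGS : G ⊆ S) {p x g : Fin m → ℝ} (hx : x ∈ G)
    (hg : g ∈ (normalSection S G (p - x)).extremePoints ℝ) : IsFacetDirection S g := by
  have hK := hS.isCompact
  obtain ⟨⟨hgN, hgq⟩, hext⟩ := mem_extremePoints.1 hg
  have hGF : G ⊆ faceAt S g := (subset_faceAt_iff hK hGS).2 hgN
  have hg0 : g ≠ 0 := by
    rintro rfl
    simp at hgq
  refine ⟨hg0, ⟨g, hg0, rfl⟩, ?_⟩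
  by_contra hdim
  have hlt : affDim (faceAt S g) < m := affDim_faceAt_lt hg0
  obtain ⟨k, hk, hk0⟩ : ∃ k ∈ perp (vectorSpan ℝ (faceAt S g) ⊔ Submodule.span ℝ {p - x}),
      k ≠ 0 := by
    refine exists_mem_perp_ne_zero ?_
    have h1 : Module.finrank ℝ (Submodule.span ℝ {p - x}) ≤ 1 := by
      simpa using finrank_span_le_card (R := ℝ) ({p - x} : Set (Fin m → ℝ))
    have h2 := Submodule.finrank_add_le_finrank_add_finrank (vectorSpan ℝ (faceAt S g))
      (Submodule.span ℝ {p - x})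
    unfold affDim at hdim hlt
    omega
  obtain ⟨hkF, hkq⟩ := mem_perp_sup_span.1 hk
  rw [mem_perp_vectorSpan] at hkF
  have hmove : ∀ k' : Fin m → ℝ, (∀ y ∈ faceAt S g, ∀ z ∈ faceAt S g, k' ⬝ᵥ y = k' ⬝ᵥ z) →
      k' ⬝ᵥ (p - x) = 0 → ∀ᶠ s : ℝ in nhds 0, g + s • k' ∈ normalSection S G (p - x) := by
    intro k' hF hq
    obtain ⟨t, rfl⟩ := hS
    filter_upwards [eventually_dotProduct_lt t g k' x] with s hs
    refine ⟨fun y hy z hz => ?_, ?_⟩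
    · have hyx : (g + s • k') ⬝ᵥ y = (g + s • k') ⬝ᵥ x := by
        simp only [add_dotProduct, smul_dotProduct, hF y (hGF hy) x (hGF hx),
          dotProduct_eq_of_mem_faceAt (hGF hy) (hGF hx)]
      rw [hyx]
      refine dotProduct_le_of_mem_convexHull (fun u hu => ?_) hz
      have huK := subset_convexHull ℝ (t : Set (Fin m → ℝ)) hu
      rcases (hgN x hx u huK).lt_or_eq with h | h
      · exact (hs u hu h).le
      · have huF : u ∈ faceAt (convexHull ℝ (t : Set (Fin m → ℝ))) g :=
          (mem_faceAt hK).2 ⟨huK, fun w hw => h ▸ hgN x hx w hw⟩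
        simp only [add_dotProduct, smul_dotProduct, h, hF u huF x (hGF hx), le_refl]
    · rw [add_dotProduct, smul_dotProduct, hq, smul_zero, add_zero, hgq]
  have h1 := hmove k hkF hkq
  have h2 := hmove (-k) (fun y hy z hz => by rw [neg_dotProduct, neg_dotProduct, hkF y hy z hz])
    (by rw [neg_dotProduct, hkq, neg_zero])
  obtain ⟨s, ⟨h1, h2⟩, hs0⟩ := (((h1.and h2).filter_mono nhdsWithin_le_nhds).and
    (self_mem_nhdsWithin : Set.Ioi (0 : ℝ) ∈ nhdsWithin 0 (Set.Ioi 0))).exists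
  have h3 := (hext _ h1 _ h2 ⟨1 / 2, 1 / 2, by norm_num, by norm_num, by norm_num, by module⟩).1
  rw [add_eq_left] at h3
  exact (smul_ne_zero (ne_of_gt hs0) hk0) h3

/-- The normal cone along `G` is generated by facet directions, in dual form: if a linear functional
`e` is negative (non-positive) at a direction `f` whose face contains `G`, then it is so at a facet
direction whose facet contains `G`. The scalar `c` normalizes `f`, and `g` is an extreme point at
which the functional attains its minimum over the cross-section of the normal cone. -/
theorem exists_isFacetDirection_dotProduct_le {m : ℕ} {S G : Set (Fin m → ℝ)}
    (hS : IsFullDimPolytope S) (hG : G.Nonempty) {f : Fin m → ℝ} (hf : f ≠ 0)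
    (hGf : G ⊆ faceAt S f) (e : Fin m → ℝ) :
    ∃ g, IsFacetDirection S g ∧ G ⊆ faceAt S g ∧ ∃ c : ℝ, 0 < c ∧ e ⬝ᵥ g ≤ c * (e ⬝ᵥ f) := by
  have hK := hS.1.isCompact
  have hGS : G ⊆ S := fun x hx => (hGf hx).1
  obtain ⟨x, hx⟩ := hG
  obtain ⟨p, hp⟩ := hS.2
  have hfq := dotProduct_lt_of_mem_interior hK hf hp (hGf hx)
  have hq : 0 < f ⬝ᵥ x - f ⬝ᵥ p := sub_pos.2 hfq
  set c := (f ⬝ᵥ x - f ⬝ᵥ p)⁻¹ with hc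
  have hc0 : 0 < c := inv_pos.2 hq
  have hfN : c • f ∈ normalSection S G (p - x) := by
    refine ⟨(subset_faceAt_iff hK hGS).1 ((faceAt_smul hK hc0 f).symm ▸ hGf), ?_⟩
    rw [smul_dotProduct, dotProduct_sub, smul_eq_mul, ← neg_sub, mul_neg, hc,
      inv_mul_cancel₀ hq.ne']
  have hN := isCompact_normalSection hp hx
  let l : StrongDual ℝ (Fin m → ℝ) :=
    LinearMap.toContinuousLinearMap (dotProductEquiv ℝ (Fin m) (-e))
  have hl : ∀ g, l g = -(e ⬝ᵥ g) := fun g => by simp [l]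
  have hexp : IsExposed ℝ (normalSection S G (p - x)) (l.toExposed (normalSection S G (p - x))) :=
    ContinuousLinearMap.toExposed.isExposed
  obtain ⟨g₀, hg₀, hmin⟩ := hN.exists_isMaxOn ⟨_, hfN⟩ l.continuous.continuousOn
  obtain ⟨g, hg⟩ := (hexp.isCompact hN).extremePoints_nonempty ⟨g₀, hg₀, fun y hy => hmin hy⟩
  have hgE := hexp.isExtreme.extremePoints_subset_extremePoints hg
  have hgN := (extremePoints_subset hgE)
  refine ⟨g, isFacetDirection_of_mem_extremePoints hS.1 hGS hx hgE,
    (subset_faceAt_iff hK hGS).2 hgN.1, c, hc0, ?_⟩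
  have h := (extremePoints_subset hg).2 _ hfN
  rw [hl, hl, dotProduct_smul, smul_eq_mul] at h
  linarith

/-- A point is singled out by a direction on the negative side of `e` exactly if it is a vertex on a
facet whose direction is on the negative side of `e`. -/
theorem exists_faceAt_eq_singleton_iff {m : ℕ} [NeZero m] {S : Set (Fin m → ℝ)}
    (hS : IsFullDimPolytope S) {e v : Fin m → ℝ} :
    (∃ f, faceAt S f = {v} ∧ e ⬝ᵥ f < 0) ↔
      v ∈ vertexSet S ∧ ∃ g, IsFacetDirection S g ∧ v ∈ faceAt S g ∧ e ⬝ᵥ g < 0 := by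
  have hK := hS.1.isCompact
  constructor
  · rintro ⟨f, hf, hef⟩
    have hf0 := ne_zero_of_faceAt_eq_singleton hK hS.2 hf
    obtain ⟨g, hg, hGg, c, hc, hle⟩ :=
      exists_isFacetDirection_dotProduct_le hS (Set.singleton_nonempty v) hf0 hf.ge e
    exact ⟨⟨f, hf0, hf.symm⟩, g, hg, hGg rfl, hle.trans_lt (mul_neg_of_pos_of_neg hc hef)⟩
  · rintro ⟨⟨h, -, hv⟩, g, -, hvg, heg⟩
    have h1 : ∀ u ∈ faceAt S g, u ≠ v → h ⬝ᵥ u < h ⬝ᵥ v := by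
      intro u hu huv
      have hvh : v ∈ faceAt S h := hv ▸ rfl
      refine lt_of_not_ge fun hle => huv ?_
      have : u ∈ faceAt S h :=
        (mem_faceAt hK).2 ⟨hu.1, fun y hy => (((mem_faceAt hK).1 hvh).2 y hy).trans hle⟩
      rwa [← hv] at this
    have h2 : ∀ᶠ s : ℝ in nhds 0, e ⬝ᵥ (g + s • h) < 0 := by
      have hc : Continuous fun s : ℝ => e ⬝ᵥ (g + s • h) := by
        simp only [dotProduct_add, dotProduct_smul]
        fun_prop
      have := hc.tendsto 0
      simp only [zero_smul, add_zero] at this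
      exact this.eventually (gt_mem_nhds heg)
    obtain ⟨s, hs, hs'⟩ := ((eventually_faceAt_eq_singleton hS.1 hvg h1).and
      (h2.filter_mono nhdsWithin_le_nhds)).exists
    exact ⟨_, hs, hs'⟩

/-! ### Ridges between facets of opposite first sign -/

theorem single_mem_vectorSpan_faceAt {m : ℕ} [NeZero m] {S : Set (Fin m → ℝ)} {f : Fin m → ℝ}
    (hf : IsFacetDirection S f) (h0 : f 0 = 0) : Pi.single 0 1 ∈ vectorSpan ℝ (faceAt S f) := by
  refine mem_of_forall_perp fun g hg => ?_
  obtain ⟨c, rfl⟩ := exists_smul_eq_of_mem_perp hf.2.2 hf.1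
    (mem_perp_vectorSpan_faceAt subset_rfl) hg
  simp [h0]

theorem single_notMem_vectorSpan {m : ℕ} [NeZero m] {S G : Set (Fin m → ℝ)} {f : Fin m → ℝ}
    (hG : G ⊆ faceAt S f) (h0 : f 0 ≠ 0) : Pi.single 0 1 ∉ vectorSpan ℝ G := fun h => by
  have := mem_perp.1 (mem_perp_vectorSpan_faceAt hG) _ h
  rw [dotProduct_single_one] at this
  exact h0 this

/-- If two directions have opposite first signs and a convex combination has first component zero,
both weights are positive, so the combination has the common part of the two faces as its face. -/
theorem faceAt_of_mem_convexHull_pair {m : ℕ} [NeZero m] {S : Set (Fin m → ℝ)} (hS : IsCompact S)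
    {f₁ f₂ g : Fin m → ℝ} (h₁ : f₁ 0 < 0) (h₂ : 0 < f₂ 0)
    (hne : (faceAt S f₁ ∩ faceAt S f₂).Nonempty) (hg : g ∈ convexHull ℝ {f₁, f₂})
    (hg0 : g 0 = 0) : faceAt S g = faceAt S f₁ ∩ faceAt S f₂ := by
  rw [convexHull_pair] at hg
  obtain ⟨a, b, ha, hb, hab, rfl⟩ := hg
  simp only [Pi.add_apply, Pi.smul_apply, smul_eq_mul] at hg0
  have ha' : 0 < a := by
    refine lt_of_le_of_ne ha fun h => ?_
    subst h
    obtain rfl : b = 1 := by linarith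
    linarith
  have hb' : 0 < b := by
    refine lt_of_le_of_ne hb fun h => ?_
    subst h
    obtain rfl : a = 1 := by linarith
    linarith
  exact faceAt_add_smul hS ha' hb' hne

/-- A face with direction orthogonal to the first axis `e`, of dimension `m - 2` and not parallel to
`e`, is the intersection of two facets of opposite first sign. The directions whose face contains
it and which are orthogonal to `e` form a line, so the facet directions minimizing and maximizing
the first component cannot have first component zero. -/
theorem exists_isOppositeIntersection {m : ℕ} [NeZero m] {S : Set (Fin m → ℝ)}
    (hS : IsFullDimPolytope S) {f : Fin m → ℝ} (hf : f ≠ 0) (h0 : f 0 = 0)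
    (hdim : affDim (faceAt S f) + 2 = m) (he : Pi.single 0 1 ∉ vectorSpan ℝ (faceAt S f)) :
    ∃ f₁ f₂, IsOppositeIntersection S (faceAt S f) f₁ f₂ := by
  have hK := hS.1.isCompact
  have hne := faceAt_nonempty hK (hS.2.mono interior_subset) f
  have hfin := finrank_sup_span_of_notMem he
  have hline : ∀ g : Fin m → ℝ, faceAt S f ⊆ faceAt S g → g 0 = 0 → ∃ c : ℝ, g = c • f := by
    intro g hg hg0
    refine exists_smul_eq_of_mem_perp (W := vectorSpan ℝ (faceAt S f) ⊔ Submodule.span ℝ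
      {Pi.single 0 1}) ?_ hf ?_ ?_
    · unfold affDim at hdim
      omega
    · exact mem_perp_sup_span.2 ⟨mem_perp_vectorSpan_faceAt subset_rfl, by simpa using h0⟩
    · exact mem_perp_sup_span.2 ⟨mem_perp_vectorSpan_faceAt hg, by simpa using hg0⟩
  -- A non-zero direction of this line is a positive multiple of `f` and has the same face.
  have hpos : ∀ g : Fin m → ℝ, g ≠ 0 → faceAt S f ⊆ faceAt S g → g 0 = 0 →
      faceAt S g = faceAt S f := by
    intro g hgne hg hg0
    obtain ⟨c, rfl⟩ := hline g hg hg0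
    refine faceAt_smul hK (lt_of_not_ge fun hc => hgne ?_) f
    obtain ⟨x, hx⟩ := hne
    refine eq_zero_of_dotProduct_const hK hS.2 hx.1 fun y hy =>
      le_antisymm (((mem_faceAt hK).1 (hg hx)).2 y hy) ?_
    simp only [smul_dotProduct, smul_eq_mul]
    exact mul_le_mul_of_nonpos_left (((mem_faceAt hK).1 hx).2 y hy) hc
  have hnz : ∀ g, IsFacetDirection S g → faceAt S f ⊆ faceAt S g → g 0 ≠ 0 := by
    intro g hg hfg hg0
    have h1 := hg.2.2
    rw [hpos g hg.1 hfg hg0] at h1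
    omega
  obtain ⟨f₁, hf₁, hG₁, c₁, -, hle₁⟩ :=
    exists_isFacetDirection_dotProduct_le hS hne hf subset_rfl (Pi.single 0 1)
  obtain ⟨f₂, hf₂, hG₂, c₂, -, hle₂⟩ :=
    exists_isFacetDirection_dotProduct_le hS hne hf subset_rfl (-Pi.single 0 1)
  simp only [neg_dotProduct, single_one_dotProduct, h0, neg_zero, mul_zero] at hle₁ hle₂
  have h₁ : f₁ 0 < 0 := lt_of_le_of_ne hle₁ (hnz f₁ hf₁ hG₁)
  have h₂ : 0 < f₂ 0 := lt_of_le_of_ne (by linarith) (hnz f₂ hf₂ hG₂).symm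
  refine ⟨f₁, f₂, hf₁, hf₂, h₁, h₂, ?_⟩
  have hGG : faceAt S f ⊆ faceAt S f₁ ∩ faceAt S f₂ := Set.subset_inter hG₁ hG₂
  have hne' := hne.mono hGG
  have hgface := faceAt_add_smul hK h₂ (neg_pos.2 h₁) hne'
  rw [← hgface]
  refine (hpos _ (fun hg => ?_) (hgface ▸ hGG) ?_).symm
  · -- The combination vanishing, `S` would be contained in the facet at `f₁`.
    rw [hg] at hgface
    obtain ⟨x, hx⟩ := hne'
    refine hf₁.1 (eq_zero_of_dotProduct_const hK hS.2 hx.1.1 fun y hy => ?_)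
    have : y ∈ faceAt S f₁ ∩ faceAt S f₂ := hgface ▸ (mem_faceAt hK).2 ⟨hy, fun z _ => by simp⟩
    exact dotProduct_eq_of_mem_faceAt this.1 hx.1
  · simp only [Pi.add_apply, Pi.smul_apply, smul_eq_mul]
    ring

/-! ### Duality between the system matrices -/

namespace LagPlant

theorem A_mulVec_single {m : ℕ} [NeZero m] (P : LagPlant m) :
    P.A *ᵥ Pi.single 0 1 = (-P.den.coeff m) • P.B := by
  ext i
  simp [A, B]

/-- The matrix of the dual plant is the inverse transpose of the system matrix. -/
theorem transpose_Astar_mul_A {m : ℕ} [NeZero m] (P : LagPlant m) : P.Astarᵀ * P.A = 1 := by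
  have hm : 0 < m := Nat.pos_of_ne_zero (NeZero.ne m)
  have hd := P.den_coeff_order_ne_zero
  have hsucc : ∀ i j : Fin m, (i : ℕ) ≠ 0 →
      (∑ k : Fin m, (if (i : ℕ) = k + 1 then (1 : ℝ) else 0) * P.A k j) =
        if i = j then 1 else 0 := by
    intro i j hi
    rw [Finset.sum_eq_single (⟨i - 1, by omega⟩ : Fin m)]
    · have h1 : (i : ℕ) = i - 1 + 1 := by omega
      have h2 : ¬ ((i : ℕ) - 1 + 1 = m) := by omega
      have h3 : ((j : ℕ) = i - 1 + 1) ↔ i = j := by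
        rw [Fin.ext_iff]
        omega
      simp only [A, of_apply, if_neg h2, if_pos h1, h3, one_mul]
    · intro k _ hk
      rw [if_neg, zero_mul]
      intro h
      exact hk (Fin.ext (by simp only; omega))
    · simp
  ext i j
  rw [mul_apply, one_apply]
  by_cases hi : (i : ℕ) = 0
  · have hterm : ∀ k : Fin m, P.Astarᵀ i k * P.A k j =
        (-P.den.coeff (m - 1 - k) / P.den.coeff m) * P.A k j := fun k => by
      simp only [Astar, transpose_apply, of_apply, if_pos hi]
    simp only [hterm]
    by_cases hj : (j : ℕ) = 0
    · rw [Finset.sum_eq_single (⟨m - 1, by omega⟩ : Fin m)]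
      · have h1 : m - 1 + 1 = m := by omega
        have h2 : i = j := Fin.ext (hi.trans hj.symm)
        simp [A, h1, hj, P.den_coeff_zero, h2, hd]
      · intro k _ hk
        have h1 : ¬ ((k : ℕ) + 1 = m) := fun h => hk (Fin.ext (by simp only; omega))
        simp [A, h1, hj]
      · simp
    · have hm1 : (m - 1 : ℕ) + 1 = m := by omega
      have hne : (⟨j - 1, by omega⟩ : Fin m) ≠ ⟨m - 1, by omega⟩ := by
        rw [Ne, Fin.mk.injEq]
        omega
      have hij : i ≠ j := fun h => hj (h ▸ hi)
      rw [Finset.sum_eq_add _ _ hne]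
      · have h1 : ¬ ((j : ℕ) - 1 + 1 = m) := by omega
        have h2 : (j : ℕ) = j - 1 + 1 := by omega
        have h3 : m - 1 - ((j : ℕ) - 1) = m - j := by omega
        simp only [A, of_apply, if_neg h1, if_pos h2, if_pos hm1, h3, if_neg hij, Nat.sub_self,
          P.den_coeff_zero]
        ring
      · rintro k - ⟨hk1, hk2⟩
        have h1 : ¬ ((k : ℕ) + 1 = m) := fun h => hk2 (Fin.ext (by simp only; omega))
        have h2 : ¬ ((j : ℕ) = k + 1) := fun h => hk1 (Fin.ext (by simp only; omega))
        simp [A, h1, h2]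
      · simp
      · simp
  · rw [← hsucc i j hi]
    refine Finset.sum_congr rfl fun k _ => ?_
    simp only [Astar, transpose_apply, of_apply, if_neg hi]

theorem Astar_mulVec_dotProduct_A_mulVec {m : ℕ} [NeZero m] (P : LagPlant m) (f x : Fin m → ℝ) :
    (P.Astar *ᵥ f) ⬝ᵥ (P.A *ᵥ x) = f ⬝ᵥ x := by
  rw [← vecMul_transpose, ← dotProduct_mulVec, mulVec_mulVec, P.transpose_Astar_mul_A, one_mulVec]

theorem Astar_mulVec_dotProduct_B {m : ℕ} [NeZero m] (P : LagPlant m) (f : Fin m → ℝ) :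
    (P.Astar *ᵥ f) ⬝ᵥ P.B = -(P.den.coeff m * f 0) / P.den.coeff m ^ 2 := by
  have hd := P.den_coeff_order_ne_zero
  have h := P.Astar_mulVec_dotProduct_A_mulVec f (Pi.single 0 1)
  rw [A_mulVec_single, dotProduct_smul, dotProduct_single_one, smul_eq_mul] at h
  rw [← h]
  field_simp

theorem Astar_mulVec_dotProduct_B_pos_iff {m : ℕ} [NeZero m] (P : LagPlant m) {f : Fin m → ℝ} :
    0 < (P.Astar *ᵥ f) ⬝ᵥ P.B ↔ P.den.coeff m * f 0 < 0 := by
  have hd : 0 < P.den.coeff m ^ 2 := by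
    have := P.den_coeff_order_ne_zero
    positivity
  rw [Astar_mulVec_dotProduct_B, div_pos_iff_of_pos_right hd, neg_pos]

theorem Astar_mulVec_dotProduct_B_neg_iff {m : ℕ} [NeZero m] (P : LagPlant m) {f : Fin m → ℝ} :
    (P.Astar *ᵥ f) ⬝ᵥ P.B < 0 ↔ 0 < P.den.coeff m * f 0 := by
  have hd : 0 < P.den.coeff m ^ 2 := by
    have := P.den_coeff_order_ne_zero
    positivity
  rw [Astar_mulVec_dotProduct_B, div_lt_iff₀ hd, zero_mul, neg_lt_zero]

theorem Astar_mulVec_dotProduct_B_eq_zero_iff {m : ℕ} [NeZero m] (P : LagPlant m)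
    {f : Fin m → ℝ} : (P.Astar *ᵥ f) ⬝ᵥ P.B = 0 ↔ f 0 = 0 := by
  have hd := P.den_coeff_order_ne_zero
  rw [Astar_mulVec_dotProduct_B]
  simp [hd]

theorem A_mulVec_injective {m : ℕ} [NeZero m] (P : LagPlant m) :
    Function.Injective fun x : Fin m → ℝ => P.A *ᵥ x := fun x y h => by
  have := congrArg (fun v => P.Astarᵀ *ᵥ v) h
  simpa [mulVec_mulVec, P.transpose_Astar_mul_A] using this

theorem A_mulVec_transpose_Astar_mulVec {m : ℕ} [NeZero m] (P : LagPlant m) (x : Fin m → ℝ) :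
    P.A *ᵥ (P.Astarᵀ *ᵥ x) = x := by
  rw [mulVec_mulVec, mul_eq_one_comm.1 P.transpose_Astar_mul_A, one_mulVec]

theorem Astar_mulVec_injective {m : ℕ} [NeZero m] (P : LagPlant m) :
    Function.Injective fun x : Fin m → ℝ => P.Astar *ᵥ x := fun x y h => by
  refine dotProduct_eq x y fun u => ?_
  rw [← P.Astar_mulVec_dotProduct_A_mulVec x u, ← P.Astar_mulVec_dotProduct_A_mulVec y u]
  exact congrArg (· ⬝ᵥ (P.A *ᵥ u)) h

theorem Astar_mulVec_surjective {m : ℕ} [NeZero m] (P : LagPlant m) :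
    Function.Surjective fun x : Fin m → ℝ => P.Astar *ᵥ x :=
  LinearMap.surjective_of_injective (f := P.Astar.mulVecLin) P.Astar_mulVec_injective

theorem Astar_mulVec_ne_zero_iff {m : ℕ} [NeZero m] (P : LagPlant m) {f : Fin m → ℝ} :
    P.Astar *ᵥ f ≠ 0 ↔ f ≠ 0 :=
  map_ne_zero_iff P.Astar.mulVecLin P.Astar_mulVec_injective

theorem B_ne_zero {m : ℕ} [NeZero m] (P : LagPlant m) : P.B ≠ 0 := fun h => by
  have hm : 0 < m := Nat.pos_of_ne_zero (NeZero.ne m)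
  have := congrFun h (⟨m - 1, by omega⟩ : Fin m)
  have h1 : m - 1 + 1 = m := by omega
  simp [B, h1] at this

/-! ### Propagation of a polytope -/

/-- The states `A x + u B` that are reached from the states `x` of `K` by inputs `|u| ≤ 1`. -/
def propagation {m : ℕ} (P : LagPlant m) (K : Set (Fin m → ℝ)) : Set (Fin m → ℝ) :=
  {x' | ∃ x ∈ K, ∃ u : ℝ, |u| ≤ 1 ∧ P.A *ᵥ x + u • P.B = x'}

theorem successors_eq_propagation {m : ℕ} (P : LagPlant m) (S : Set (Fin m → ℝ)) (z : ℝ) :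
    P.successors S z = P.propagation (P.consistent S z) := by
  ext x'
  constructor
  · rintro ⟨x, hx, u, y, rfl, rfl, hu, hz⟩
    exact ⟨x, ⟨hx, hz⟩, u, hu, rfl⟩
  · rintro ⟨x, ⟨hx, hz⟩, u, hu, rfl⟩
    exact ⟨x, hx, u, _, rfl, rfl, hu, hz⟩

open scoped Pointwise in
theorem isPolytope_propagation {m : ℕ} (P : LagPlant m) {K : Set (Fin m → ℝ)} (hK : IsPolytope K) :
    IsPolytope (P.propagation K) := by
  classical
  obtain ⟨t, rfl⟩ := hK
  refine ⟨t.image (fun x => P.A *ᵥ x) + ({P.B, -P.B} : Finset (Fin m → ℝ)), ?_⟩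
  have h1 : P.A.mulVecLin '' convexHull ℝ (t : Set (Fin m → ℝ)) =
      convexHull ℝ ((fun x => P.A *ᵥ x) '' t) :=
    LinearMap.image_convexHull P.A.mulVecLin t
  rw [Finset.coe_add, convexHull_add, Finset.coe_image, ← h1, Finset.coe_insert,
    Finset.coe_singleton, convexHull_pair]
  ext x'
  rw [Set.mem_add]
  constructor
  · rintro ⟨x, hx, u, hu, rfl⟩
    rw [abs_le] at hu
    exact ⟨_, ⟨x, hx, rfl⟩, _, ⟨(1 + u) / 2, (1 - u) / 2, by linarith, by linarith, by ring, rfl⟩,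
      by rw [mulVecLin_apply]; module⟩
  · rintro ⟨_, ⟨x, hx, rfl⟩, _, ⟨a, b, ha, hb, hab, rfl⟩, rfl⟩
    refine ⟨x, hx, a - b, ?_, ?_⟩
    · rw [abs_le]
      constructor <;> linarith
    · rw [mulVecLin_apply]
      module

theorem isFullDimPolytope_propagation {m : ℕ} [NeZero m] (P : LagPlant m) {K : Set (Fin m → ℝ)}
    (hK : IsFullDimPolytope K) : IsFullDimPolytope (P.propagation K) := by
  refine ⟨P.isPolytope_propagation hK.1, ?_⟩
  have hc : Continuous fun x' : Fin m → ℝ => P.Astarᵀ *ᵥ x' :=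
    P.Astarᵀ.mulVecLin.continuous_of_finiteDimensional
  obtain ⟨p, hp⟩ := hK.2
  refine ⟨P.A *ᵥ p, mem_interior.2
    ⟨_, ?_, isOpen_interior.preimage hc, (?_ : P.Astarᵀ *ᵥ (P.A *ᵥ p) ∈ interior K)⟩⟩
  · intro x' hx'
    refine ⟨P.Astarᵀ *ᵥ x', interior_subset hx', 0, by simp, ?_⟩
    rw [zero_smul, add_zero, A_mulVec_transpose_Astar_mulVec]
  · rwa [mulVec_mulVec, P.transpose_Astar_mul_A, one_mulVec]

/-- The face of the propagated set at `A* f` consists of the states `A x + u B` with `x` in the face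
at `f` and `u` maximizing `u ⟨A* f, B⟩`. -/
theorem mem_faceAt_propagation_iff {m : ℕ} [NeZero m] (P : LagPlant m) {K : Set (Fin m → ℝ)}
    (hK : IsPolytope K) {f x : Fin m → ℝ} {u : ℝ} (hx : x ∈ K) (hu : |u| ≤ 1) :
    P.A *ᵥ x + u • P.B ∈ faceAt (P.propagation K) (P.Astar *ᵥ f) ↔
      x ∈ faceAt K f ∧ u * ((P.Astar *ᵥ f) ⬝ᵥ P.B) = |(P.Astar *ᵥ f) ⬝ᵥ P.B| := by
  have hval : ∀ (y : Fin m → ℝ) (v : ℝ), (P.Astar *ᵥ f) ⬝ᵥ (P.A *ᵥ y + v • P.B) =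
      f ⬝ᵥ y + v * ((P.Astar *ᵥ f) ⬝ᵥ P.B) := fun y v => by
    rw [dotProduct_add, Astar_mulVec_dotProduct_A_mulVec, dotProduct_smul, smul_eq_mul]
  have hle : ∀ v : ℝ, |v| ≤ 1 →
      v * ((P.Astar *ᵥ f) ⬝ᵥ P.B) ≤ |(P.Astar *ᵥ f) ⬝ᵥ P.B| := fun v hv => by
    refine (le_abs_self _).trans ?_
    rw [abs_mul]
    exact mul_le_of_le_one_left (abs_nonneg _) hv
  rw [mem_faceAt (P.isPolytope_propagation hK).isCompact, mem_faceAt hK.isCompact]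
  constructor
  · rintro ⟨-, h⟩
    have h' : ∀ y ∈ K, ∀ v : ℝ, |v| ≤ 1 → f ⬝ᵥ y + v * ((P.Astar *ᵥ f) ⬝ᵥ P.B) ≤
        f ⬝ᵥ x + u * ((P.Astar *ᵥ f) ⬝ᵥ P.B) := fun y hy v hv => by
      rw [← hval, ← hval]
      exact h _ ⟨y, hy, v, hv, rfl⟩
    refine ⟨⟨hx, fun y hy => by simpa using h' y hy u hu⟩, le_antisymm (hle u hu) ?_⟩
    rw [abs_le']
    constructor
    · simpa using h' x hx 1 (by simp)
    · simpa using h' x hx (-1) (by simp)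
  · rintro ⟨⟨-, hmax⟩, heq⟩
    refine ⟨⟨x, hx, u, hu, rfl⟩, ?_⟩
    rintro _ ⟨y, hy, v, hv, rfl⟩
    rw [hval, hval, heq]
    exact add_le_add (hmax y hy) (hle v hv)

/-- The face at `A* f` is, up to a linear isomorphism, a translate of the face of `K` at `f` if
`f 0 ≠ 0`, and the face of `K` at `f` swept along the first axis if `f 0 = 0`. -/
theorem affDim_faceAt_propagation {m : ℕ} [NeZero m] (P : LagPlant m) {K : Set (Fin m → ℝ)}
    (hK : IsFullDimPolytope K) (f : Fin m → ℝ) :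
    (f 0 ≠ 0 → affDim (faceAt (P.propagation K) (P.Astar *ᵥ f)) = affDim (faceAt K f)) ∧
    (f 0 = 0 → affDim (faceAt (P.propagation K) (P.Astar *ᵥ f)) =
      Module.finrank ℝ (vectorSpan ℝ (faceAt K f) ⊔ Submodule.span ℝ {Pi.single 0 1} :
        Submodule ℝ (Fin m → ℝ))) := by
  -- It suffices to compare the orthogonal complements along the bijection `A*`.
  have key : ∀ W : Submodule ℝ (Fin m → ℝ), (∀ h, P.Astar *ᵥ h ∈
      perp (vectorSpan ℝ (faceAt (P.propagation K) (P.Astar *ᵥ f))) ↔ h ∈ perp W) →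
      affDim (faceAt (P.propagation K) (P.Astar *ᵥ f)) = Module.finrank ℝ W := by
    intro W hW
    have h1 : perp (vectorSpan ℝ (faceAt (P.propagation K) (P.Astar *ᵥ f))) =
        (perp W).map P.Astar.mulVecLin := by
      ext g
      obtain ⟨h, rfl⟩ := P.Astar_mulVec_surjective g
      rw [Submodule.mem_map]
      refine (hW h).trans ⟨fun hh => ⟨h, hh, rfl⟩, ?_⟩
      rintro ⟨h', hh', heq⟩
      exact P.Astar_mulVec_injective heq ▸ hh'
    have h2 := finrank_add_finrank_perp (vectorSpan ℝ (faceAt (P.propagation K) (P.Astar *ᵥ f)))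
    have h3 := finrank_add_finrank_perp W
    rw [h1,
      ← (Submodule.equivMapOfInjective P.Astar.mulVecLin P.Astar_mulVec_injective _).finrank_eq]
      at h2
    unfold affDim
    omega
  have hdot : ∀ (h y : Fin m → ℝ) (v : ℝ), (P.Astar *ᵥ h) ⬝ᵥ (P.A *ᵥ y + v • P.B) =
      h ⬝ᵥ y + v * ((P.Astar *ᵥ h) ⬝ᵥ P.B) := fun h y v => by
    rw [dotProduct_add, Astar_mulVec_dotProduct_A_mulVec, dotProduct_smul, smul_eq_mul]
  constructor
  · intro hf
    rw [Ne, ← P.Astar_mulVec_dotProduct_B_eq_zero_iff] at hf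
    refine key _ fun h => ?_
    rw [mem_perp_vectorSpan, mem_perp_vectorSpan]
    constructor
    · intro H x hx y hy
      obtain ⟨u, hu, hub⟩ : ∃ u : ℝ, |u| ≤ 1 ∧
          u * ((P.Astar *ᵥ f) ⬝ᵥ P.B) = |(P.Astar *ᵥ f) ⬝ᵥ P.B| := by
        rcases abs_choice ((P.Astar *ᵥ f) ⬝ᵥ P.B) with h | h
        · exact ⟨1, by simp, by rw [h, one_mul]⟩
        · exact ⟨-1, by simp, by rw [h, neg_one_mul]⟩
      have := H _ ((P.mem_faceAt_propagation_iff hK.1 hx.1 hu).2 ⟨hx, hub⟩)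
        _ ((P.mem_faceAt_propagation_iff hK.1 hy.1 hu).2 ⟨hy, hub⟩)
      rw [hdot, hdot] at this
      linarith
    · intro H x' hx' y' hy'
      obtain ⟨x, hx, u, hu, rfl⟩ := hx'.1
      obtain ⟨y, hy, v, hv, rfl⟩ := hy'.1
      obtain ⟨hxF, hxu⟩ := (P.mem_faceAt_propagation_iff hK.1 hx hu).1 hx'
      obtain ⟨hyF, hyv⟩ := (P.mem_faceAt_propagation_iff hK.1 hy hv).1 hy'
      rw [hdot, hdot, H x hxF y hyF, mul_right_cancel₀ hf (hxu.trans hyv.symm)]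
  · intro hf
    have hb := P.Astar_mulVec_dotProduct_B_eq_zero_iff.2 hf
    refine key _ fun h => ?_
    rw [mem_perp_sup_span, mem_perp_vectorSpan, mem_perp_vectorSpan, dotProduct_single_one,
      ← P.Astar_mulVec_dotProduct_B_eq_zero_iff]
    have hmem : ∀ x ∈ faceAt K f, ∀ u : ℝ, |u| ≤ 1 →
        P.A *ᵥ x + u • P.B ∈ faceAt (P.propagation K) (P.Astar *ᵥ f) := fun x hx u hu =>
      (P.mem_faceAt_propagation_iff hK.1 hx.1 hu).2 ⟨hx, by simp [hb]⟩
    constructor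
    · intro H
      constructor
      · intro x hx y hy
        have := H _ (hmem x hx 0 (by simp)) _ (hmem y hy 0 (by simp))
        rw [hdot, hdot] at this
        simpa using this
      · obtain ⟨x, hx⟩ := faceAt_nonempty hK.1.isCompact (hK.2.mono interior_subset) f
        have := H _ (hmem x hx 1 (by simp)) _ (hmem x hx 0 (by simp))
        simpa [hdot] using this
    · rintro ⟨H, H0⟩ x' hx' y' hy'
      obtain ⟨x, hx, u, hu, rfl⟩ := hx'.1
      obtain ⟨y, hy, v, hv, rfl⟩ := hy'.1
      obtain ⟨hxF, -⟩ := (P.mem_faceAt_propagation_iff hK.1 hx hu).1 hx'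
      obtain ⟨hyF, -⟩ := (P.mem_faceAt_propagation_iff hK.1 hy hv).1 hy'
      rw [hdot, hdot, H0, H x hxF y hyF, mul_zero, mul_zero]

theorem gT_eq {m : ℕ} (P : LagPlant m) (x : Fin m → ℝ) :
    P.gT x = P.A *ᵥ x + (1 : ℝ) • P.B := by
  rw [one_smul, gT]

theorem gB_eq {m : ℕ} (P : LagPlant m) (x : Fin m → ℝ) :
    P.gB x = P.A *ᵥ x + (-1 : ℝ) • P.B := by
  rw [neg_one_smul, ← sub_eq_add_neg, gB]

theorem gT_mem_faceAt_propagation_iff {m : ℕ} [NeZero m] (P : LagPlant m) {K : Set (Fin m → ℝ)}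
    (hK : IsPolytope K) {f x : Fin m → ℝ} (hx : x ∈ K) :
    P.gT x ∈ faceAt (P.propagation K) (P.Astar *ᵥ f) ↔
      x ∈ faceAt K f ∧ P.den.coeff m * f 0 ≤ 0 := by
  rw [gT_eq, P.mem_faceAt_propagation_iff hK hx (by simp), one_mul, eq_comm (b := |_|), abs_eq_self,
    ← not_lt, P.Astar_mulVec_dotProduct_B_neg_iff, not_lt]

theorem gB_mem_faceAt_propagation_iff {m : ℕ} [NeZero m] (P : LagPlant m) {K : Set (Fin m → ℝ)}
    (hK : IsPolytope K) {f x : Fin m → ℝ} (hx : x ∈ K) :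
    P.gB x ∈ faceAt (P.propagation K) (P.Astar *ᵥ f) ↔
      x ∈ faceAt K f ∧ 0 ≤ P.den.coeff m * f 0 := by
  rw [gB_eq, P.mem_faceAt_propagation_iff hK hx (by simp), neg_one_mul, eq_comm (b := |_|),
    abs_eq_neg_self, ← not_lt, P.Astar_mulVec_dotProduct_B_pos_iff, not_lt]

/-! ### Vertices and facets of the propagated polytope -/

/-- A vertex of the propagated polytope is the image of a point of `K` under one of the extreme
inputs, and that point is singled out in `K` by a direction on the matching side. -/
theorem mem_vertexSet_propagation_iff {m : ℕ} [NeZero m] (P : LagPlant m) {K : Set (Fin m → ℝ)}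
    (hK : IsFullDimPolytope K) {x' : Fin m → ℝ} :
    x' ∈ vertexSet (P.propagation K) ↔ ∃ x,
      (x' = P.gT x ∧ ∃ f, faceAt K f = {x} ∧ P.den.coeff m * f 0 < 0) ∨
      (x' = P.gB x ∧ ∃ f, faceAt K f = {x} ∧ 0 < P.den.coeff m * f 0) := by
  have hQ := P.isFullDimPolytope_propagation hK
  -- If `⟨A* f, B⟩ ≠ 0`, only the input `u = σ` occurs in the face at `A* f`.
  have hsingle : ∀ (f x : Fin m → ℝ) (σ : ℝ), |σ| ≤ 1 → f 0 ≠ 0 →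
      σ * ((P.Astar *ᵥ f) ⬝ᵥ P.B) = |(P.Astar *ᵥ f) ⬝ᵥ P.B| → faceAt K f = {x} →
      P.A *ᵥ x + σ • P.B ∈ vertexSet (P.propagation K) := by
    intro f x σ hσ hf hb hx
    have hxF : x ∈ faceAt K f := hx ▸ rfl
    rw [Ne, ← P.Astar_mulVec_dotProduct_B_eq_zero_iff] at hf
    have hface : faceAt (P.propagation K) (P.Astar *ᵥ f) = {P.A *ᵥ x + σ • P.B} := by
      ext y'
      rw [Set.mem_singleton_iff]
      constructor
      · intro hy'
        obtain ⟨y, hy, v, hv, rfl⟩ := hy'.1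
        obtain ⟨hyF, hyv⟩ := (P.mem_faceAt_propagation_iff hK.1 hy hv).1 hy'
        rw [hx] at hyF
        rw [Set.mem_singleton_iff.1 hyF, mul_right_cancel₀ hf (hyv.trans hb.symm)]
      · rintro rfl
        exact (P.mem_faceAt_propagation_iff hK.1 hxF.1 hσ).2 ⟨hxF, hb⟩
    exact ⟨_, ne_zero_of_faceAt_eq_singleton hQ.1.isCompact hQ.2 hface, hface.symm⟩
  constructor
  · rintro ⟨g, -, hg⟩
    obtain ⟨f, rfl⟩ := P.Astar_mulVec_surjective g
    have hx' : x' ∈ faceAt (P.propagation K) (P.Astar *ᵥ f) := hg ▸ rfl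
    have huniq : ∀ y' ∈ faceAt (P.propagation K) (P.Astar *ᵥ f), y' = x' := fun y' hy' => by
      rw [← hg] at hy'
      exact hy'
    obtain ⟨x, hx, u, hu, rfl⟩ := hx'.1
    obtain ⟨hxF, hxu⟩ := (P.mem_faceAt_propagation_iff hK.1 hx hu).1 hx'
    have hf : faceAt K f = {x} := by
      refine Set.eq_singleton_iff_unique_mem.2 ⟨hxF, fun y hy => P.A_mulVec_injective ?_⟩
      exact add_right_cancel
        (huniq _ ((P.mem_faceAt_propagation_iff hK.1 hy.1 hu).2 ⟨hy, hxu⟩))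
    refine ⟨x, ?_⟩
    rcases lt_trichotomy (P.den.coeff m * f 0) 0 with hlt | heq | hgt
    · left
      refine ⟨(huniq _ ?_).symm, f, hf, hlt⟩
      exact (P.gT_mem_faceAt_propagation_iff hK.1 hx).2 ⟨hxF, hlt.le⟩
    · exfalso
      have h1 := huniq _ ((P.gT_mem_faceAt_propagation_iff hK.1 hx).2 ⟨hxF, heq.le⟩)
      have h2 := huniq _ ((P.gB_mem_faceAt_propagation_iff hK.1 hx).2 ⟨hxF, heq.ge⟩)
      have h3 := h1.trans h2.symm
      rw [gT, gB, sub_eq_add_neg] at h3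
      exact P.B_ne_zero (self_eq_neg.1 (add_left_cancel h3))
    · right
      refine ⟨(huniq _ ?_).symm, f, hf, hgt⟩
      exact (P.gB_mem_faceAt_propagation_iff hK.1 hx).2 ⟨hxF, hgt.le⟩
  · rintro ⟨x, ⟨rfl, f, hf, hlt⟩ | ⟨rfl, f, hf, hgt⟩⟩
    · rw [gT_eq]
      refine hsingle f x 1 (by simp) (right_ne_zero_of_mul hlt.ne) ?_ hf
      rw [one_mul, abs_of_pos (P.Astar_mulVec_dotProduct_B_pos_iff.2 hlt)]
    · rw [gB_eq]
      refine hsingle f x (-1) (by simp) (right_ne_zero_of_mul hgt.ne') ?_ hf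
      rw [neg_one_mul, abs_of_neg (P.Astar_mulVec_dotProduct_B_neg_iff.2 hgt)]

/-- The images of two points under opposite extreme inputs cannot agree if the first one is a
vertex: it would be passed by the second point in the direction singling out the vertex. -/
theorem gT_ne_gB {m : ℕ} [NeZero m] (P : LagPlant m) {K : Set (Fin m → ℝ)} (hK : IsPolytope K)
    {x y f : Fin m → ℝ} (hy : y ∈ K) (hf : faceAt K f = {x})
    (hlt : P.den.coeff m * f 0 < 0) : P.gT x ≠ P.gB y := fun h => by
  have h1 := congrArg (fun v => (P.Astar *ᵥ f) ⬝ᵥ v) h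
  simp only [gT, gB, dotProduct_add, dotProduct_sub, Astar_mulVec_dotProduct_A_mulVec] at h1
  have h2 := P.Astar_mulVec_dotProduct_B_pos_iff.2 hlt
  have h3 := ((mem_faceAt hK.isCompact).1 (hf ▸ rfl : x ∈ faceAt K f)).2 y hy
  linarith

theorem isFacetDirection_Astar_mulVec {m : ℕ} [NeZero m] (P : LagPlant m) {K : Set (Fin m → ℝ)}
    (hK : IsFullDimPolytope K) {f : Fin m → ℝ} (hf : IsFacetDirection K f) :
    IsFacetDirection (P.propagation K) (P.Astar *ᵥ f) := by
  have h0 := P.Astar_mulVec_ne_zero_iff.2 hf.1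
  refine ⟨h0, ⟨_, h0, rfl⟩, ?_⟩
  obtain ⟨h1, h2⟩ := P.affDim_faceAt_propagation hK f
  by_cases hf0 : f 0 = 0
  · have hmem := single_mem_vectorSpan_faceAt hf hf0
    rw [h2 hf0, sup_eq_left.2 ((Submodule.span_singleton_le_iff_mem _ _).2 hmem)]
    exact hf.2.2
  · rw [h1 hf0]
    exact hf.2.2

theorem isFacetDirection_Astar_mulVec_of_ridge {m : ℕ} [NeZero m] (P : LagPlant m)
    {K : Set (Fin m → ℝ)} (hK : IsFullDimPolytope K) {f f₁ : Fin m → ℝ}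
    (hdim : affDim (faceAt K f) + 2 = m) (hf0 : f 0 = 0) (hsub : faceAt K f ⊆ faceAt K f₁)
    (hf₁ : f₁ 0 ≠ 0) : IsFacetDirection (P.propagation K) (P.Astar *ᵥ f) := by
  have hne : f ≠ 0 := by
    rintro rfl
    -- The face at `0` is all of `K`, on which `f₁` would be constant.
    obtain ⟨x, hx⟩ := hK.2.mono interior_subset
    have hall : ∀ y ∈ K, y ∈ faceAt K f₁ := fun y hy =>
      hsub ((mem_faceAt hK.1.isCompact).2 ⟨hy, fun z _ => by simp⟩)
    have := eq_zero_of_dotProduct_const hK.1.isCompact hK.2 hx fun y hy =>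
      dotProduct_eq_of_mem_faceAt (hall y hy) (hall x hx)
    rw [this] at hf₁
    exact hf₁ rfl
  have h0 := P.Astar_mulVec_ne_zero_iff.2 hne
  refine ⟨h0, ⟨_, h0, rfl⟩, ?_⟩
  rw [(P.affDim_faceAt_propagation hK f).2 hf0,
    finrank_sup_span_of_notMem (single_notMem_vectorSpan hsub hf₁)]
  exact hdim

/-- Conversely, a facet of the propagated polytope comes from a facet or, if it is parallel to the
input direction, possibly from a ridge between facets of opposite first sign. -/
theorem isFacetDirection_or_of_isFacetDirection_propagation {m : ℕ} [NeZero m] (P : LagPlant m)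
    {K : Set (Fin m → ℝ)} (hK : IsFullDimPolytope K) {f : Fin m → ℝ}
    (hf : IsFacetDirection (P.propagation K) (P.Astar *ᵥ f)) :
    IsFacetDirection K f ∨ f 0 = 0 ∧ faceAt K f ∈ oppositeRidges K := by
  have hne := P.Astar_mulVec_ne_zero_iff.1 hf.1
  obtain ⟨h1, h2⟩ := P.affDim_faceAt_propagation hK f
  have hdim := hf.2.2
  by_cases hf0 : f 0 = 0
  · rw [h2 hf0] at hdim
    by_cases hmem : Pi.single 0 1 ∈ vectorSpan ℝ (faceAt K f)
    · rw [sup_eq_left.2 ((Submodule.span_singleton_le_iff_mem _ _).2 hmem)] at hdim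
      exact Or.inl ⟨hne, ⟨f, hne, rfl⟩, hdim⟩
    · rw [finrank_sup_span_of_notMem hmem] at hdim
      exact Or.inr ⟨hf0, ⟨⟨f, hne, rfl⟩, hdim⟩,
        exists_isOppositeIntersection hK hne hf0 hdim hmem⟩
  · rw [h1 hf0] at hdim
    exact Or.inl ⟨hne, ⟨f, hne, rfl⟩, hdim⟩

/-- The face at `A* f` depends only on the face at `f` and on the sign of the first component. -/
theorem faceAt_propagation_congr {m : ℕ} [NeZero m] (P : LagPlant m) {K : Set (Fin m → ℝ)}
    (hK : IsPolytope K) {f g : Fin m → ℝ} (h : faceAt K f = faceAt K g) {c : ℝ} (hc : 0 < c)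
    (h0 : g 0 = c * f 0) :
    faceAt (P.propagation K) (P.Astar *ᵥ f) = faceAt (P.propagation K) (P.Astar *ᵥ g) := by
  have hb : (P.Astar *ᵥ g) ⬝ᵥ P.B = c * ((P.Astar *ᵥ f) ⬝ᵥ P.B) := by
    rw [Astar_mulVec_dotProduct_B, Astar_mulVec_dotProduct_B, h0]
    ring
  ext x'
  suffices H : ∀ x ∈ K, ∀ u : ℝ, |u| ≤ 1 →
      (P.A *ᵥ x + u • P.B ∈ faceAt (P.propagation K) (P.Astar *ᵥ f) ↔
        P.A *ᵥ x + u • P.B ∈ faceAt (P.propagation K) (P.Astar *ᵥ g)) by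
    constructor
    · intro hx'
      obtain ⟨x, hx, u, hu, rfl⟩ := hx'.1
      exact (H x hx u hu).1 hx'
    · intro hx'
      obtain ⟨x, hx, u, hu, rfl⟩ := hx'.1
      exact (H x hx u hu).2 hx'
  intro x hx u hu
  rw [P.mem_faceAt_propagation_iff hK hx hu, P.mem_faceAt_propagation_iff hK hx hu, h, hb, abs_mul,
    abs_of_pos hc, mul_left_comm, mul_right_inj' hc.ne']

end LagPlant

/-! ### The table -/

namespace LagPlant

/-- The direction of `K` underlying each row heading: `f_i` for the first three blocks of rows and
`f^R_l` for the last one. -/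
def rowDirection {m nf nR : ℕ} (F : Matrix (Fin m) (Fin nf) ℝ) (FR : Matrix (Fin m) (Fin nR) ℝ) :
    Fin nf ⊕ (Fin nf ⊕ (Fin nf ⊕ Fin nR)) → Fin m → ℝ :=
  Sum.elim F.col (Sum.elim F.col (Sum.elim F.col FR.col))

/-- The rows of the table whose direction has the sign that belongs to their block. -/
def IsActiveRow {m nf nR : ℕ} [NeZero m] (P : LagPlant m) (F : Matrix (Fin m) (Fin nf) ℝ) :
    Fin nf ⊕ (Fin nf ⊕ (Fin nf ⊕ Fin nR)) → Prop :=
  Sum.elim (fun i => P.den.coeff m * F 0 i < 0) (Sum.elim (fun i => 0 < P.den.coeff m * F 0 i)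
    (Sum.elim (fun i => F 0 i = 0) fun _ => True))

theorem Fplus_col {m nf nR : ℕ} [NeZero m] (P : LagPlant m) (F : Matrix (Fin m) (Fin nf) ℝ)
    (FR : Matrix (Fin m) (Fin nR) ℝ) (r : Fin nf ⊕ (Fin nf ⊕ (Fin nf ⊕ Fin nR))) :
    (P.Fplus F FR).col r = P.Astar *ᵥ rowDirection F FR r := by
  rcases r with i | i | i | l <;> rfl

theorem Vplus_col_inl {m nv : ℕ} [NeZero m] (P : LagPlant m) (V : Matrix (Fin m) (Fin nv) ℝ)
    (j : Fin nv) : (P.Vplus V).col (Sum.inl j) = P.gT (V.col j) := rfl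

theorem Vplus_col_inr {m nv : ℕ} [NeZero m] (P : LagPlant m) (V : Matrix (Fin m) (Fin nv) ℝ)
    (j : Fin nv) : (P.Vplus V).col (Sum.inr j) = P.gB (V.col j) := rfl

theorem nonzeroCols_eq_one_iff {nv nf : ℕ} {J : Matrix (Fin nf) (Fin nv) ℕ} {j : Fin nv} :
    nonzeroCols J j = 1 ↔ ∃ i, J i j ≠ 0 := by
  simp only [nonzeroCols, ite_eq_left_iff, zero_ne_one, imp_false, not_not]
  exact Function.ne_iff

theorem IT_eq {m nv nf : ℕ} [NeZero m] (P : LagPlant m) (F : Matrix (Fin m) (Fin nf) ℝ)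
    (I : Matrix (Fin nf) (Fin nv) ℕ) (i : Fin nf) (j : Fin nv) [Decidable (I i j = 1)]
    [Decidable (P.den.coeff m * F 0 i < 0)] :
    P.IT F I i j = if I i j = 1 ∧ P.den.coeff m * F 0 i < 0 then 1 else 0 := by
  simp [IT, selectRows, IFT]

theorem IB_eq {m nv nf : ℕ} [NeZero m] (P : LagPlant m) (F : Matrix (Fin m) (Fin nf) ℝ)
    (I : Matrix (Fin nf) (Fin nv) ℕ) (i : Fin nf) (j : Fin nv) [Decidable (I i j = 1)]
    [Decidable (0 < P.den.coeff m * F 0 i)] :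
    P.IB F I i j = if I i j = 1 ∧ 0 < P.den.coeff m * F 0 i then 1 else 0 := by
  simp [IB, selectRows, IFB]

theorem IVPT_eq_one_iff {m nv nf : ℕ} [NeZero m] (P : LagPlant m) {F : Matrix (Fin m) (Fin nf) ℝ}
    {I : Matrix (Fin nf) (Fin nv) ℕ} {j : Fin nv} :
    P.IVPT F I j = 1 ↔ ∃ i, I i j = 1 ∧ P.den.coeff m * F 0 i < 0 := by
  classical
  simp [IVPT, nonzeroCols_eq_one_iff, IT_eq]

theorem IVPB_eq_one_iff {m nv nf : ℕ} [NeZero m] (P : LagPlant m) {F : Matrix (Fin m) (Fin nf) ℝ}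
    {I : Matrix (Fin nf) (Fin nv) ℕ} {j : Fin nv} :
    P.IVPB F I j = 1 ↔ ∃ i, I i j = 1 ∧ 0 < P.den.coeff m * F 0 i := by
  classical
  simp [IVPB, nonzeroCols_eq_one_iff, IB_eq]

theorem Iplus_col_inl_ne_zero_iff {m nv nf nR : ℕ} [NeZero m] (P : LagPlant m)
    (V : Matrix (Fin m) (Fin nv) ℝ) (F : Matrix (Fin m) (Fin nf) ℝ)
    (I : Matrix (Fin nf) (Fin nv) ℕ) (R : Fin nR → Set (Fin m → ℝ)) (j : Fin nv) :
    (P.Iplus V F I R).col (Sum.inl j) ≠ 0 ↔ P.IVPT F I j = 1 := by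
  classical
  constructor
  · intro h
    obtain ⟨r, hr⟩ := Function.ne_iff.1 h
    rcases r with i | i | i | l
    · exact nonzeroCols_eq_one_iff.2 ⟨i, hr⟩
    · exact absurd rfl hr
    · by_contra hc
      exact hr (if_neg fun h' => hc h'.2.1)
    · by_contra hc
      exact hr (if_neg fun h' => hc h'.1)
  · intro h
    obtain ⟨i, hi⟩ := nonzeroCols_eq_one_iff.1 h
    exact Function.ne_iff.2 ⟨Sum.inl i, hi⟩

theorem Iplus_col_inr_ne_zero_iff {m nv nf nR : ℕ} [NeZero m] (P : LagPlant m)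
    (V : Matrix (Fin m) (Fin nv) ℝ) (F : Matrix (Fin m) (Fin nf) ℝ)
    (I : Matrix (Fin nf) (Fin nv) ℕ) (R : Fin nR → Set (Fin m → ℝ)) (j : Fin nv) :
    (P.Iplus V F I R).col (Sum.inr j) ≠ 0 ↔ P.IVPB F I j = 1 := by
  classical
  constructor
  · intro h
    obtain ⟨r, hr⟩ := Function.ne_iff.1 h
    rcases r with i | i | i | l
    · exact absurd rfl hr
    · exact nonzeroCols_eq_one_iff.2 ⟨i, hr⟩
    · by_contra hc
      exact hr (if_neg fun h' => hc h'.2.1)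
    · by_contra hc
      exact hr (if_neg fun h' => hc h'.1)
  · intro h
    obtain ⟨i, hi⟩ := nonzeroCols_eq_one_iff.1 h
    exact Function.ne_iff.2 ⟨Sum.inr (Sum.inl i), hi⟩

end LagPlant

/-- A facet direction condition that is invariant under positive scaling can be checked on the
listed facet directions. -/
theorem IsVertexFacetDescription.exists_isFacetDirection_iff {m nv nf : ℕ} {K : Set (Fin m → ℝ)}
    (hK : IsFullDimPolytope K) {V : Matrix (Fin m) (Fin nv) ℝ} {F : Matrix (Fin m) (Fin nf) ℝ}
    {I : Matrix (Fin nf) (Fin nv) ℕ} (h : IsVertexFacetDescription K V F I) (e : Fin m → ℝ)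
    (j : Fin nv) :
    (∃ i, I i j = 1 ∧ e ⬝ᵥ F.col i < 0) ↔
      ∃ g, IsFacetDirection K g ∧ V.col j ∈ faceAt K g ∧ e ⬝ᵥ g < 0 := by
  have hI : ∀ i, I i j = 1 ↔ V.col j ∈ faceAt K (F.col i) := fun i => by
    simp [h.incidence, incidenceMatrix]
  constructor
  · rintro ⟨i, hi, he⟩
    exact ⟨_, h.facets.1 i, (hI i).1 hi, he⟩
  · rintro ⟨g, hg, hv, he⟩
    obtain ⟨i, hi⟩ := h.facets.2.2.ge hg.2
    obtain ⟨c, hc, rfl⟩ :=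
      exists_pos_smul_eq_of_faceAt_eq hK.1.isCompact hK.2 (h.facets.1 i) hg.1 hi
    refine ⟨i, (hI i).2 (hi.ge hv), ?_⟩
    rw [dotProduct_smul, smul_eq_mul] at he
    exact (pos_iff_neg_of_mul_neg he).1 hc

namespace LagPlant

/-- The table for an arbitrary full-dimensional polytope `K` in place of the consistent states. -/
theorem isVertexFacetDescription_propagation {m nv nf nR : ℕ} [NeZero m] (P : LagPlant m)
    {K : Set (Fin m → ℝ)} (hK : IsFullDimPolytope K) {V : Matrix (Fin m) (Fin nv) ℝ}
    {F : Matrix (Fin m) (Fin nf) ℝ} {I : Matrix (Fin nf) (Fin nv) ℕ}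
    (hVFI : IsVertexFacetDescription K V F I) {R : Fin nR → Set (Fin m → ℝ)}
    (hRinj : Function.Injective R) (hR : Set.range R = oppositeRidges K)
    {FR : Matrix (Fin m) (Fin nR) ℝ} (hFR : ∀ l, IsRidgeDirection K (R l) (FR.col l)) :
    IsVertexFacetDescription (P.propagation K)
      ((P.Vplus V).submatrix id (Subtype.val : NonzeroCol (P.Iplus V F I R) → _))
      ((P.Fplus F FR).submatrix id (Subtype.val : NonzeroRow (P.Iplus V F I R) → _))
      (removeZeros (P.Iplus V F I R)) := by
  classical
  have hQ := P.isFullDimPolytope_propagation hK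
  have hKc := hK.1.isCompact
  have hd := P.den_coeff_order_ne_zero
  have hVmem : ∀ j, V.col j ∈ vertexSet K := fun j => hVFI.vertices.2.le ⟨j, rfl⟩
  have hVK : ∀ j, V.col j ∈ K := fun j => by
    obtain ⟨f, -, hf⟩ := hVmem j
    exact (hf.le rfl : V.col j ∈ faceAt K f).1
  have hI : ∀ i j, I i j = 1 ↔ V.col j ∈ faceAt K (F.col i) := fun i j => by
    simp [hVFI.incidence, incidenceMatrix]
  -- The markings of the vertices.
  have hT : ∀ j, P.IVPT F I j = 1 ↔ ∃ f, faceAt K f = {V.col j} ∧ P.den.coeff m * f 0 < 0 := by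
    intro j
    have h1 := hVFI.exists_isFacetDirection_iff hK (Pi.single 0 (P.den.coeff m)) j
    have h2 := exists_faceAt_eq_singleton_iff hK (e := Pi.single 0 (P.den.coeff m)) (v := V.col j)
    simp only [single_dotProduct] at h1 h2
    rw [h2, P.IVPT_eq_one_iff, ← h1]
    exact ⟨fun h => ⟨hVmem j, h⟩, fun h => h.2⟩
  have hB : ∀ j, P.IVPB F I j = 1 ↔ ∃ f, faceAt K f = {V.col j} ∧ 0 < P.den.coeff m * f 0 := by
    intro j
    have h1 := hVFI.exists_isFacetDirection_iff hK (Pi.single 0 (-P.den.coeff m)) j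
    have h2 := exists_faceAt_eq_singleton_iff hK (e := Pi.single 0 (-P.den.coeff m)) (v := V.col j)
    simp only [single_dotProduct, neg_mul, neg_lt_zero] at h1 h2
    rw [h2, P.IVPB_eq_one_iff, ← h1]
    exact ⟨fun h => ⟨hVmem j, h⟩, fun h => h.2⟩
  have hcol : ∀ c, (P.Iplus V F I R).col c ≠ 0 →
      (P.Vplus V).col c ∈ vertexSet (P.propagation K) := by
    rintro (j | j) hc
    · rw [Iplus_col_inl_ne_zero_iff, hT] at hc
      exact (P.mem_vertexSet_propagation_iff hK).2 ⟨_, Or.inl ⟨rfl, hc⟩⟩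
    · rw [Iplus_col_inr_ne_zero_iff, hB] at hc
      exact (P.mem_vertexSet_propagation_iff hK).2 ⟨_, Or.inr ⟨rfl, hc⟩⟩
  have hcol_surj : ∀ x' ∈ vertexSet (P.propagation K), ∃ c,
      (P.Iplus V F I R).col c ≠ 0 ∧ (P.Vplus V).col c = x' := by
    intro x' hx'
    obtain ⟨x, ⟨rfl, f, hf, hlt⟩ | ⟨rfl, f, hf, hgt⟩⟩ := (P.mem_vertexSet_propagation_iff hK).1 hx'
    all_goals
      obtain ⟨j, rfl⟩ := hVFI.vertices.2.ge
        (⟨f, ne_zero_of_faceAt_eq_singleton hKc hK.2 hf, hf.symm⟩ : x ∈ vertexSet K)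
    · exact ⟨Sum.inl j, (P.Iplus_col_inl_ne_zero_iff V F I R j).2 ((hT j).2 ⟨f, hf, hlt⟩), rfl⟩
    · exact ⟨Sum.inr j, (P.Iplus_col_inr_ne_zero_iff V F I R j).2 ((hB j).2 ⟨f, hf, hgt⟩), rfl⟩
  have hcol_inj : ∀ c c', (P.Iplus V F I R).col c ≠ 0 → (P.Iplus V F I R).col c' ≠ 0 →
      (P.Vplus V).col c = (P.Vplus V).col c' → c = c' := by
    rintro (j | j) (j' | j') hc hc' h
    · rw [Vplus_col_inl, Vplus_col_inl, gT, gT] at h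
      rw [hVFI.vertices.1 (P.A_mulVec_injective (add_right_cancel h))]
    · rw [Iplus_col_inl_ne_zero_iff, hT] at hc
      obtain ⟨f, hf, hlt⟩ := hc
      exact absurd h (P.gT_ne_gB hK.1 (hVK j') hf hlt)
    · rw [Iplus_col_inl_ne_zero_iff, hT] at hc'
      obtain ⟨f, hf, hlt⟩ := hc'
      exact absurd h.symm (P.gT_ne_gB hK.1 (hVK j) hf hlt)
    · rw [Vplus_col_inr, Vplus_col_inr, gB, gB] at h
      rw [hVFI.vertices.1 (P.A_mulVec_injective (sub_left_injective h))]
  -- The rows.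
  have hRface : ∀ l, FR 0 l = 0 ∧ faceAt K (FR.col l) = R l ∧ affDim (R l) + 2 = m ∧
      ∃ f₁, R l ⊆ faceAt K f₁ ∧ f₁ 0 ≠ 0 := by
    intro l
    obtain ⟨f₁, f₂, ⟨-, -, h₁, h₂, hl⟩, hconv, h0⟩ := hFR l
    obtain ⟨⟨⟨f, -, hf⟩, hdim⟩, -⟩ : R l ∈ oppositeRidges K := hR.le ⟨l, rfl⟩
    have hne : (R l).Nonempty := hf ▸ faceAt_nonempty hKc (hK.2.mono interior_subset) f
    refine ⟨h0, ?_, hdim, f₁, hl.le.trans Set.inter_subset_left, h₁.ne⟩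
    rw [faceAt_of_mem_convexHull_pair hKc h₁ h₂ (hl ▸ hne) hconv h0, hl]
  have hrow_dir : ∀ r, IsActiveRow (nR := nR) P F r →
      IsFacetDirection (P.propagation K) (P.Astar *ᵥ rowDirection F FR r) := by
    rintro (i | i | i | l) -
    · exact P.isFacetDirection_Astar_mulVec hK (hVFI.facets.1 i)
    · exact P.isFacetDirection_Astar_mulVec hK (hVFI.facets.1 i)
    · exact P.isFacetDirection_Astar_mulVec hK (hVFI.facets.1 i)
    · obtain ⟨h0, hface, hdim, f₁, hsub, h₁⟩ := hRface l
      exact P.isFacetDirection_Astar_mulVec_of_ridge hK (hface.symm ▸ hdim) h0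
        (hface.symm ▸ hsub) h₁
  have hinactive : ∀ r c, ¬ IsActiveRow (nR := nR) P F r → P.Iplus V F I R r c = 0 := by
    rintro (i | i | i | l) (j | j) h
    · exact (P.IT_eq F I i j).trans (if_neg fun h' => h h'.2)
    · rfl
    · rfl
    · exact (P.IB_eq F I i j).trans (if_neg fun h' => h h'.2)
    · exact if_neg fun h' => h (by simpa [IFO, IsActiveRow] using h'.1)
    · exact if_neg fun h' => h (by simpa [IFO, IsActiveRow] using h'.1)
    · exact absurd trivial h
    · exact absurd trivial h
  have hentry : ∀ r c, IsActiveRow (nR := nR) P F r → (P.Iplus V F I R).col c ≠ 0 →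
      P.Iplus V F I R r c = if (P.Vplus V).col c ∈
        faceAt (P.propagation K) (P.Astar *ᵥ rowDirection F FR r) then 1 else 0 := by
    rintro r (j | j) hr hc
    · rw [Iplus_col_inl_ne_zero_iff] at hc
      rw [Vplus_col_inl]
      simp only [P.gT_mem_faceAt_propagation_iff hK.1 (hVK j)]
      rcases r with i | i | i | l
      · have hr' : P.den.coeff m * F 0 i < 0 := hr
        refine (P.IT_eq F I i j).trans (if_congr ?_ rfl rfl)
        rw [hI]
        exact and_congr_right fun _ => ⟨le_of_lt, fun _ => hr'⟩
      · have hr' : 0 < P.den.coeff m * F 0 i := hr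
        exact (if_neg fun h => hr'.not_ge h.2).symm
      · have hr' : F 0 i = 0 := hr
        refine if_congr ?_ rfl rfl
        rw [hI]
        simp [IFO, rowDirection, hr', hc]
      · obtain ⟨h0, hface, -⟩ := hRface l
        refine if_congr ?_ rfl rfl
        simp [IRV, rowDirection, h0, hface, hc]
    · rw [Iplus_col_inr_ne_zero_iff] at hc
      rw [Vplus_col_inr]
      simp only [P.gB_mem_faceAt_propagation_iff hK.1 (hVK j)]
      rcases r with i | i | i | l
      · have hr' : P.den.coeff m * F 0 i < 0 := hr
        exact (if_neg fun h => hr'.not_ge h.2).symm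
      · have hr' : 0 < P.den.coeff m * F 0 i := hr
        refine (P.IB_eq F I i j).trans (if_congr ?_ rfl rfl)
        rw [hI]
        exact and_congr_right fun _ => ⟨le_of_lt, fun _ => hr'⟩
      · have hr' : F 0 i = 0 := hr
        refine if_congr ?_ rfl rfl
        rw [hI]
        simp [IFO, rowDirection, hr', hc]
      · obtain ⟨h0, hface, -⟩ := hRface l
        refine if_congr ?_ rfl rfl
        simp [IRV, rowDirection, h0, hface, hc]
  have hrow : ∀ r, (P.Iplus V F I R).row r ≠ 0 ↔ IsActiveRow (nR := nR) P F r := by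
    intro r
    constructor
    · intro h
      by_contra hr
      exact h (funext fun c => hinactive r c hr)
    · -- The facet of an active row contains a vertex, whose column has a one in this row.
      intro hr
      obtain ⟨x', hx', hmem⟩ :=
        exists_mem_vertexSet_of_faceAt hQ (P.Astar *ᵥ rowDirection F FR r)
      obtain ⟨c, hc, rfl⟩ := hcol_surj x' hx'
      refine Function.ne_iff.2 ⟨c, ?_⟩
      change P.Iplus V F I R r c ≠ 0
      rw [hentry r c hr hc, if_pos hmem]
      exact one_ne_zero
  have hrow_inj : ∀ r r', IsActiveRow (nR := nR) P F r → IsActiveRow (nR := nR) P F r' →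
      faceAt (P.propagation K) (P.Astar *ᵥ rowDirection F FR r) =
        faceAt (P.propagation K) (P.Astar *ᵥ rowDirection F FR r') → r = r' := by
    intro r r' hr hr' h
    obtain ⟨c, hc, heq⟩ := exists_pos_smul_eq_of_faceAt_eq hQ.1.isCompact hQ.2 (hrow_dir r hr)
      (hrow_dir r' hr').1 h
    rw [← mulVec_smul] at heq
    replace heq : rowDirection F FR r' = c • rowDirection F FR r := P.Astar_mulVec_injective heq
    have hface : faceAt K (rowDirection F FR r') = faceAt K (rowDirection F FR r) := by
      rw [heq, faceAt_smul hKc hc]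
    have h0 : P.den.coeff m * rowDirection F FR r' 0 =
        c * (P.den.coeff m * rowDirection F FR r 0) := by
      rw [heq, Pi.smul_apply, smul_eq_mul]
      ring
    have hsign : SignType.sign (P.den.coeff m * rowDirection F FR r' 0) =
        SignType.sign (P.den.coeff m * rowDirection F FR r 0) := by
      rw [h0, sign_mul, sign_pos hc, one_mul]
    have hFdim : ∀ i, affDim (faceAt K (F.col i)) + 1 = m := fun i => (hVFI.facets.1 i).2.2
    have hsT : ∀ i, P.den.coeff m * F 0 i < 0 →
        SignType.sign (P.den.coeff m * F.col i 0) = -1 := fun i hi => sign_neg hi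
    have hsB : ∀ i, 0 < P.den.coeff m * F 0 i →
        SignType.sign (P.den.coeff m * F.col i 0) = 1 := fun i hi => sign_pos hi
    have hsO : ∀ i, F 0 i = 0 → SignType.sign (P.den.coeff m * F.col i 0) = 0 := fun i hi => by
      simp [hi]
    have hsR : ∀ l, SignType.sign (P.den.coeff m * FR.col l 0) = 0 := fun l => by
      simp [(hRface l).1]
    rcases r with i | i | i | l <;> rcases r' with i' | i' | i' | l' <;>
      simp only [rowDirection, IsActiveRow, Sum.elim_inl, Sum.elim_inr] at hface hsign hr hr'
    · rw [hVFI.facets.2.1 hface]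
    · exact absurd ((hsB i' hr').symm.trans (hsign.trans (hsT i hr))) (by decide)
    · exact absurd ((hsO i' hr').symm.trans (hsign.trans (hsT i hr))) (by decide)
    · exact absurd ((hsR l').symm.trans (hsign.trans (hsT i hr))) (by decide)
    · exact absurd ((hsT i' hr').symm.trans (hsign.trans (hsB i hr))) (by decide)
    · rw [hVFI.facets.2.1 hface]
    · exact absurd ((hsO i' hr').symm.trans (hsign.trans (hsB i hr))) (by decide)
    · exact absurd ((hsR l').symm.trans (hsign.trans (hsB i hr))) (by decide)
    · exact absurd ((hsT i' hr').symm.trans (hsign.trans (hsO i hr))) (by decide)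
    · exact absurd ((hsB i' hr').symm.trans (hsign.trans (hsO i hr))) (by decide)
    · rw [hVFI.facets.2.1 hface]
    · obtain ⟨-, hl, hdim, -⟩ := hRface l'
      have := hFdim i
      rw [← hface, hl] at this
      omega
    · exact absurd ((hsT i' hr').symm.trans (hsign.trans (hsR l))) (by decide)
    · exact absurd ((hsB i' hr').symm.trans (hsign.trans (hsR l))) (by decide)
    · obtain ⟨-, hl, hdim, -⟩ := hRface l
      have := hFdim i'
      rw [hface, hl] at this
      omega
    · rw [(hRface l).2.1, (hRface l').2.1] at hface
      rw [hRinj hface]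
  have hrow_surj : ∀ f, IsFacetDirection (P.propagation K) (P.Astar *ᵥ f) →
      ∃ r, IsActiveRow (nR := nR) P F r ∧
        faceAt (P.propagation K) (P.Astar *ᵥ rowDirection F FR r) =
          faceAt (P.propagation K) (P.Astar *ᵥ f) := by
    intro f hf
    rcases P.isFacetDirection_or_of_isFacetDirection_propagation hK hf with h | ⟨h0, h⟩
    · obtain ⟨i, hi⟩ := hVFI.facets.2.2.ge h.2
      obtain ⟨c, hc, rfl⟩ := exists_pos_smul_eq_of_faceAt_eq hKc hK.2 (hVFI.facets.1 i) h.1 hi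
      have hcongr := P.faceAt_propagation_congr hK.1 hi hc (by simp)
      rcases lt_trichotomy (P.den.coeff m * F 0 i) 0 with hlt | heq | hgt
      · exact ⟨Sum.inl i, hlt, hcongr⟩
      · exact ⟨Sum.inr (Sum.inr (Sum.inl i)), (mul_eq_zero.1 heq).resolve_left hd, hcongr⟩
      · exact ⟨Sum.inr (Sum.inl i), hgt, hcongr⟩
    · obtain ⟨l, hl⟩ := hR.ge h
      obtain ⟨hl0, hface, -⟩ := hRface l
      refine ⟨Sum.inr (Sum.inr (Sum.inr l)), trivial,
        P.faceAt_propagation_congr hK.1 (hface.trans hl) one_pos ?_⟩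
      rw [h0, one_mul]
      exact hl0.symm
  refine ⟨⟨?_, ?_⟩, ⟨?_, ?_, ?_⟩, ?_⟩
  · rintro ⟨c, hc⟩ ⟨c', hc'⟩ h
    exact Subtype.ext (hcol_inj c c' hc hc' h)
  · refine Set.Subset.antisymm ?_ fun x' hx' => ?_
    · rintro _ ⟨⟨c, hc⟩, rfl⟩
      exact hcol c hc
    · obtain ⟨c, hc, rfl⟩ := hcol_surj x' hx'
      exact ⟨⟨c, hc⟩, rfl⟩
  · rintro ⟨r, hr⟩
    change IsFacetDirection _ ((P.Fplus F FR).col r)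
    rw [Fplus_col]
    exact hrow_dir r ((hrow r).1 hr)
  · rintro ⟨r, hr⟩ ⟨r', hr'⟩ h
    change faceAt _ ((P.Fplus F FR).col r) = faceAt _ ((P.Fplus F FR).col r') at h
    rw [Fplus_col, Fplus_col] at h
    exact Subtype.ext (hrow_inj r r' ((hrow r).1 hr) ((hrow r').1 hr') h)
  · refine Set.Subset.antisymm ?_ fun G hG => ?_
    · rintro _ ⟨⟨r, hr⟩, rfl⟩
      change IsFacet _ (faceAt _ ((P.Fplus F FR).col r))
      rw [Fplus_col]
      exact (hrow_dir r ((hrow r).1 hr)).2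
    · obtain ⟨g, hg, rfl⟩ := hG.1
      obtain ⟨f, rfl⟩ := P.Astar_mulVec_surjective g
      obtain ⟨r, hr, hface⟩ := hrow_surj f ⟨hg, hG⟩
      refine ⟨⟨r, (hrow r).2 hr⟩, ?_⟩
      change faceAt _ ((P.Fplus F FR).col r) = _
      rw [Fplus_col]
      exact hface
  · ext ⟨r, hr⟩ ⟨c, hc⟩
    change P.Iplus V F I R r c =
      if (P.Vplus V).col c ∈ faceAt _ ((P.Fplus F FR).col r) then 1 else 0
    rw [Fplus_col, hentry r c ((hrow r).1 hr) hc]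

end LagPlant

theorem mainTheorem1 {m nv nf nR : ℕ} [NeZero m] (P : LagPlant m)
    -- the current uncertainty set and the new measurement
    (S : Set (Fin m → ℝ)) (z : ℝ)
    (hS : IsFullDimPolytope (P.consistent S z))
    -- its description by vertices, facets and incidences, after the measurement `z`
    (V : Matrix (Fin m) (Fin nv) ℝ) (F : Matrix (Fin m) (Fin nf) ℝ)
    (I : Matrix (Fin nf) (Fin nv) ℕ)
    (hVFI : IsVertexFacetDescription (P.consistent S z) V F I)
    -- its ridges between facets of opposite first sign, with their directions
    (R : Fin nR → Set (Fin m → ℝ)) (hRinj : Function.Injective R)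
    (hR : Set.range R = oppositeRidges (P.consistent S z))
    (FR : Matrix (Fin m) (Fin nR) ℝ)
    (hFR : ∀ l, IsRidgeDirection (P.consistent S z) (R l) (FR.col l)) :
    IsFullDimPolytope (P.successors S z) ∧
    IsVertexFacetDescription (P.successors S z)
      ((P.Vplus V).submatrix id (Subtype.val : NonzeroCol (P.Iplus V F I R) → _))
      ((P.Fplus F FR).submatrix id (Subtype.val : NonzeroRow (P.Iplus V F I R) → _))
      (removeZeros (P.Iplus V F I R)) := by
  rw [P.successors_eq_propagation]
  exact ⟨P.isFullDimPolytope_propagation hS,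
    P.isVertexFacetDescription_propagation hS hVFI hRinj hR hFR⟩
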